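/- Let $\mathfrak F$ be the class of differentiable functions $\Psi:\mathbb R\to[0,1]$ such that $\Psi'\le 0$, $\Psi'$ is Riemann integrable (on every bounded interval), $\Psi\in L^1(0,\infty)$ and $1-\Psi\in L^1(-\infty,0)$. Put $\Phi=-\Psi'$ and let $\mathfrak F'$ be the set of $\Psi\in\mathfrak F$ for which there is $c>0$ with $\Phi(x)\le e^{-c|x|}$ for all $x\in\mathbb R$. Let $h_n(x)=e^{x^2/2}\frac{(-1)^n}{\sqrt{n!\,2^n\sqrt\pi}}\frac{d^n}{dx^n}e^{-x^2}$ be the Hermite functions, and for real $N>0$ let $\varphi_k(x)=\sqrt{\frac{\pi\sqrt N}{\sqrt2}}\;h_k\!\left(x\frac{\pi\sqrt N}{\sqrt2}\right)$. For $\tau>0$ and $\alpha\in(0,1)$ the kernel of the modified GUE is $$K^N_{\Psi,\alpha}(x,y)=\sum_{k=0}^\infty \Psi\!\left(\frac{k-N}{\tau N^\alpha}\right)\varphi_k(x)\varphi_k(y).$$ For $k\in\mathbb Z$ let $\xi_k=\xi_k(N)\in(0,1)$ be any number (it exists by the mean value theorem) with $\frac1{\tau N^\alpha}\Phi\!\left(\frac{k+\xi_k}{\tau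 N^\alpha}\right)=\Psi\!\left(\frac{k}{\tau N^\alpha}\right)-\Psi\!\left(\frac{k+1}{\tau N^\alpha}\right)$, and let $$L^N_{\Psi,\eta}(x,y)=\frac1{\tau N^\alpha}\sum_{k\in\mathbb Z,\ |k|\le\Gamma N^\alpha}\Phi\!\left(\frac{k+\xi_k}{\tau N^\alpha}\right)\frac{\sin[2\pi\eta(k)(x-y)]}{\pi(x-y)},\qquad \Gamma=(\log N)^2,\quad \eta(k)=\tfrac12N^{1-\alpha}\sqrt{1+k/N},$$ where the quotient is read as $2\eta(k)$ when $x=y$ (and $\sqrt{1+k/N}$ as $0$ when $k<-N$, which does not occur for large $N$). For a kernel $K$ on $\mathbb R$, a continuous compactly supported $f:\mathbb R\to\mathbb R$ and $n\ge1$, the $n$-th cumulant is $$C^n_K[\Xi f]=\sum_{\ell=1}^n\frac{(-1)^{\ell+1}}{\ell}\sum_{\substack{m_1,\dots,m_\ell\ge1\\ m_1+\dots+m_\ell=n}}\frac{n!}{m_1!\cdots m_\ell!}\int_{\mathbb R^\ell}\prod_{i=1}^{\ell}f(x_i)^{m_i}K(x_i,x_{i+1})\,dx_1\cdots dx_\ell\qquad(x_{\ell+1}=x_1).$$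 Two families of kernels $(K^N)_{N>0}$, $(L^N)_{N>0}$ are asymptotically equivalent, $K^N\cong L^N$, if for all continuous compactly supported $f:\mathbb R\to\mathbb R$ and all $n\ge1$ their cumulants have the same asymptotics, $\lim_{N\to\infty}\big(C^n_{K^N}[\Xi f]-C^n_{L^N}[\Xi f]\big)=0$ (so if either cumulant has a finite or infinite limit, the other one has the same limit). **Proposition.** Let $\Psi\in\mathfrak F'$, $\tau>0$ and $1/3<\alpha<1$. Then for every $N>0$ the series defining $K^N_{\Psi,\alpha}$ converges absolutely at all $x,y\in\mathbb R$ and the integrals in the cumulants of the two kernels below converge absolutely, and as $N\to\infty$ $$N^{-\alpha}K^N_{\Psi,\alpha}(xN^{-\alpha},yN^{-\alpha})\;\cong\;L^N_{\Psi,\eta}(x,y).$$ -/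

import Mathlib

open Filter Topology MeasureTheory

noncomputable section

/-- `g` is Riemann integrable on every bounded interval `[a, b]` (Mathlib's Riemann box integral in
dimension one, with respect to Lebesgue measure). -/
def IsLocallyRiemannIntegrable (g : ℝ → ℝ) : Prop :=
  ∀ (a b : ℝ) (hab : a < b),
    BoxIntegral.Integrable
      (⟨fun _ => a, fun _ => b, fun _ => hab⟩ : BoxIntegral.Box (Fin 1))
      BoxIntegral.IntegrationParams.Riemann
      (fun x : Fin 1 → ℝ => g (x 0))
      (volume : Measure (Fin 1 → ℝ)).toBoxAdditive.toSMul

/-- The class `𝔉` of shapes: differentiable non-increasing functions `Ψ : ℝ → [0,1]` with Riemann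
integrable derivative such that `Ψ ∈ L¹(0,∞)` and `1 - Ψ ∈ L¹(-∞,0)`. (Since `Ψ` is bounded and
monotone, the improper Riemann integral of `Ψ'` over `ℝ` then converges automatically.) -/
structure IsShape (Ψ : ℝ → ℝ) : Prop where
  mem_Icc : ∀ x, Ψ x ∈ Set.Icc (0 : ℝ) 1
  differentiable : Differentiable ℝ Ψ
  deriv_nonpos : ∀ x, deriv Ψ x ≤ 0
  riemann : IsLocallyRiemannIntegrable (deriv Ψ)
  integrableOn_right : IntegrableOn Ψ (Set.Ioi 0)
  integrableOn_left : IntegrableOn (fun x => 1 - Ψ x) (Set.Iio 0)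

/-- The density `Φ = -Ψ'` of a shape. -/
def shapeDensity (Ψ : ℝ → ℝ) (x : ℝ) : ℝ := -deriv Ψ x

/-- The subclass `𝔉'`: shapes with `Φ(x) ≤ exp(-c|x|)` for some `c > 0` and all `x`. -/
structure IsExpShape (Ψ : ℝ → ℝ) : Prop extends IsShape Ψ where
  density_le : ∃ c : ℝ, 0 < c ∧ ∀ x, shapeDensity Ψ x ≤ Real.exp (-c * |x|)

/-- The Hermite functions
`h_n(x) = exp(x²/2) (-1)ⁿ / √(n! 2ⁿ √π) · dⁿ/dxⁿ exp(-x²)`. -/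
def hermiteFun (n : ℕ) (x : ℝ) : ℝ :=
  Real.exp (x ^ 2 / 2) * ((-1) ^ n / √((n.factorial : ℝ) * 2 ^ n * √Real.pi)) *
    iteratedDeriv n (fun t : ℝ => Real.exp (-t ^ 2)) x

/-- The rescaled Hermite functions `φ_k(x) = √(π√N/√2) h_k(x π√N/√2)`. -/
def rescaledHermite (N : ℝ) (k : ℕ) (x : ℝ) : ℝ :=
  √(Real.pi * √N / √2) * hermiteFun k (x * (Real.pi * √N / √2))

/-- The general term `Ψ((k-N)/(τ N^α)) φ_k(x) φ_k(y)` of the series for the modified GUE kernel. -/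
def modifiedGUETerm (Ψ : ℝ → ℝ) (τ α N x y : ℝ) (k : ℕ) : ℝ :=
  Ψ (((k : ℝ) - N) / (τ * N ^ α)) * rescaledHermite N k x * rescaledHermite N k y

/-- The correlation kernel of the modified GUE with shape `Ψ`, temperature `τ`, modification
scale `α` and density `N`. -/
def modifiedGUEKernel (Ψ : ℝ → ℝ) (τ α N x y : ℝ) : ℝ :=
  ∑' k : ℕ, modifiedGUETerm Ψ τ α N x y k

/-- The sine kernel `sin(2πη u)/(πu)`, continuously extended by `2η` at `u = 0`. -/
def sineFun (η u : ℝ) : ℝ :=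
  if u = 0 then 2 * η else Real.sin (2 * Real.pi * η * u) / (Real.pi * u)

/-- `ξ` is a point of `(0,1)` given by the mean value theorem for `Ψ` on
`[k/(τ N^α), (k+1)/(τ N^α)]`. -/
def IsMeanValuePoint (Ψ : ℝ → ℝ) (τ α N : ℝ) (k : ℤ) (ξ : ℝ) : Prop :=
  ξ ∈ Set.Ioo (0 : ℝ) 1 ∧
    1 / (τ * N ^ α) * shapeDensity Ψ (((k : ℝ) + ξ) / (τ * N ^ α)) =
      Ψ ((k : ℝ) / (τ * N ^ α)) - Ψ (((k : ℝ) + 1) / (τ * N ^ α))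

/-- Mean value points exist for every differentiable function. -/
theorem exists_isMeanValuePoint {Ψ : ℝ → ℝ} (hΨ : Differentiable ℝ Ψ) {τ N : ℝ} (hτ : 0 < τ)
    (hN : 0 < N) (α : ℝ) (k : ℤ) : ∃ ξ, IsMeanValuePoint Ψ τ α N k ξ := by
  have hs : 0 < τ * N ^ α := mul_pos hτ (Real.rpow_pos_of_pos hN α)
  set s := τ * N ^ α with hs_def
  have hlt : (k : ℝ) / s < ((k : ℝ) + 1) / s := by gcongr; linarith
  obtain ⟨c, ⟨hc1, hc2⟩, hc⟩ :=
    exists_deriv_eq_slope Ψ hlt hΨ.continuous.continuousOn hΨ.differentiableOn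
  refine ⟨c * s - k, ⟨?_, ?_⟩, ?_⟩
  · rw [div_lt_iff₀ hs] at hc1; linarith
  · rw [lt_div_iff₀ hs] at hc2; linarith
  · have h1 : ((k : ℝ) + (c * s - k)) / s = c := by field_simp; ring
    have h2 : ((k : ℝ) + 1) / s - (k : ℝ) / s = 1 / s := by ring
    rw [← hs_def, h1, shapeDensity, hc, h2]
    field_simp
    ring

/-- The mixture of sine kernels
`L(x,y) = 1/(τN^α) ∑_{|k| ≤ Γ N^α} Φ((k+ξ_k)/(τN^α)) sin(2πη(k)(x-y)) / (π(x-y))`. -/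
def sineMixtureKernel (Ψ : ℝ → ℝ) (τ α Γ : ℝ) (η : ℤ → ℝ) (ξ : ℤ → ℝ) (N x y : ℝ) : ℝ :=
  1 / (τ * N ^ α) * ∑ k ∈ Finset.Icc (-⌊Γ * N ^ α⌋) ⌊Γ * N ^ α⌋,
    shapeDensity Ψ (((k : ℝ) + ξ k) / (τ * N ^ α)) * sineFun (η k) (x - y)

/-- The integrand `∏ᵢ f(xᵢ)^{mᵢ} K(xᵢ, xᵢ₊₁)`, with cyclic indices, of the trace
`Tr[f^{m₁} K ⋯ f^{m_ℓ} K]` attached to a composition `m` of `n` of length `ℓ`. -/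
def traceIntegrand (K : ℝ → ℝ → ℝ) (f : ℝ → ℝ) {n : ℕ} (m : Composition n)
    (x : Fin m.length → ℝ) : ℝ :=
  ∏ i, f (x i) ^ m.blocksFun i * K (x i) (x (finRotate m.length i))

/-- The `n`-th cumulant of the linear statistic of `f` with respect to the kernel `K`:
`∑_m (-1)^{ℓ+1}/ℓ · n!/(m₁!⋯m_ℓ!) · Tr[f^{m₁} K ⋯ f^{m_ℓ} K]`,
summed over the compositions `m` of `n`. -/
def kernelCumulant (K : ℝ → ℝ → ℝ) (f : ℝ → ℝ) (n : ℕ) : ℝ :=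
  ∑ m : Composition n,
    (-1) ^ (m.length + 1) / (m.length : ℝ) *
      ((n.factorial : ℝ) / ∏ i, ((m.blocksFun i).factorial : ℝ)) *
      ∫ x : Fin m.length → ℝ, traceIntegrand K f m x

/-- All the traces that occur in the cumulants of `K`, for continuous compactly supported test
functions, are absolutely convergent integrals. -/
def HasCumulants (K : ℝ → ℝ → ℝ) : Prop :=
  ∀ f : ℝ → ℝ, Continuous f → HasCompactSupport f → ∀ n : ℕ, 1 ≤ n → ∀ m : Composition n,
    Integrable (traceIntegrand K f m)

/-- Asymptotic equivalence of two families of kernels on `ℝ`: for every continuous compactly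
supported `f` and every `n ≥ 1`, the cumulants `C^n_{K^N}[Ξf]` and `C^n_{L^N}[Ξf]` have the same
asymptotics as `N → ∞`. As these cumulants may diverge (for instance the mean, `n = 1`), this is
expressed by their difference tending to `0`; in particular, if one of them has a limit, finite or
infinite, then the other one has the same limit. -/
def AsymptoticallyEquivalent (K L : ℝ → ℝ → ℝ → ℝ) : Prop :=
  ∀ f : ℝ → ℝ, Continuous f → HasCompactSupport f → ∀ n : ℕ, 1 ≤ n →
    Tendsto (fun N : ℝ => kernelCumulant (K N) f n - kernelCumulant (L N) f n) atTop (𝓝 0)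

/-- The modified GUE kernel at its own scale: `N^{-α} K^N(x N^{-α}, y N^{-α})`. -/
def criticalModifiedGUEKernel (Ψ : ℝ → ℝ) (τ α N x y : ℝ) : ℝ :=
  N ^ (-α) * modifiedGUEKernel Ψ τ α N (x * N ^ (-α)) (y * N ^ (-α))

/-- The mixture of sine kernels with `Γ = (log N)²` and `η(k) = N^{1-α} √(1 + k/N) / 2`. -/
def criticalSineMixtureKernel (Ψ : ℝ → ℝ) (τ α : ℝ) (ξ : ℝ → ℤ → ℝ) (N x y : ℝ) : ℝ :=
  sineMixtureKernel Ψ τ α (Real.log N ^ 2)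
    (fun k => N ^ (1 - α) * √(1 + (k : ℝ) / N) / 2) (ξ N) N x y

end

/-!
Summation by parts writes the kernel of the modified GUE, up to exponentially small terms, as the
mixture of the Hermite projection kernels `S_{N+k}`, `|k| ≤ (log N)² N^α`, with the increments
`Ψ(k / (τ N^α)) - Ψ((k + 1) / (τ N^α))` as weights; the mean value points of the statement turn
`L^N` into the mixture of sine kernels with the same weights.

By the Christoffel–Darboux formula, `u ↦ (u - v) S_n(u, v)` is a combination of Hermite functions
and hence solves `Z'' + 2 n Z = r` with a bounded forcing `r`. Variation of constants then compares
`S_n(u, v)` with `S_n(v, v) sinc(ω (u - v))`, `ω² ≈ 2 n`; the density `S_n(v, v)` is within a small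
error of `S_n(0, 0)`, which is controlled by an exact recursion as in Wallis' product. For
`|u|, |v| ≤ X` the error is `O((X² + 1) / √N)`. Here `X` is of order `N^{1/2 - α}`, and so is the
dilation factor of the kernels, so that the rescaled error is `O(N^{1 - 3α} + N^{-α})`. This
tends to zero precisely because `α > 1/3`.

On a compact set both kernels are bounded by `min(N², 1 / |x - y|)` up to the uniform error
`ε = O(N^{-δ})`. Interpolation gives the bound `N^{2κ} |x - y|^{κ - 1}`, whose integral over a row
is `O(N^{2κ})` for every `κ > 0`. Telescoping `∏ K - ∏ L` replaces one factor at a time by `ε`,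
hence the difference of two cumulants of order `n` is `O(ε N^{2κn})`, and `κ` can be chosen small.
-/

noncomputable section

open Real

theorem apply_le_apply_zero_of_hasDerivAt {F g : ℝ → ℝ} (hF : ∀ t, HasDerivAt F (-t * g t) t)
    (hg : ∀ t, 0 ≤ g t) (v : ℝ) : F v ≤ F 0 := by
  have hdiff : Differentiable ℝ F := fun t => (hF t).differentiableAt
  rcases le_total 0 v with hv | hv
  · refine antitoneOn_of_deriv_nonpos (convex_Ici 0) hdiff.continuous.continuousOn
      hdiff.differentiableOn (fun t ht => ?_) Set.self_mem_Ici hv hv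
    rw [interior_Ici, Set.mem_Ioi] at ht
    rw [(hF t).deriv, neg_mul, neg_nonpos]
    exact mul_nonneg ht.le (hg t)
  · refine monotoneOn_of_deriv_nonneg (convex_Iic 0) hdiff.continuous.continuousOn
      hdiff.differentiableOn (fun t ht => ?_) hv Set.self_mem_Iic hv
    rw [interior_Iic, Set.mem_Iio] at ht
    rw [(hF t).deriv]
    exact mul_nonneg (neg_nonneg.2 ht.le) (hg t)

/- Variation of constants: `ω Z(t) cos(ω(u - t)) + Z'(t) sin(ω(u - t))` has derivative
`r(t) sin(ω(u - t))` and equals `ω Z(u)` at `t = u`. -/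
theorem abs_sub_harmonic_le {Z Z' r : ℝ → ℝ} {s : Set ℝ} (hs : Convex ℝ s) {ω C u v : ℝ}
    (hZ : ∀ t, HasDerivAt Z (Z' t) t) (hZ' : ∀ t, HasDerivAt Z' (r t - ω ^ 2 * Z t) t)
    (hr : ∀ t ∈ s, |r t| ≤ C) (hu : u ∈ s) (hv : v ∈ s) :
    |ω * Z u - (ω * Z v * cos (ω * (u - v)) + Z' v * sin (ω * (u - v)))| ≤ C * |u - v| := by
  have hphase (t : ℝ) : HasDerivAt (fun t => ω * (u - t)) (-ω) t := by
    simpa using ((hasDerivAt_id t).const_sub u).const_mul ω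
  have hderiv (t : ℝ) : HasDerivAt
      (fun t => ω * Z t * cos (ω * (u - t)) + Z' t * sin (ω * (u - t)))
      (r t * sin (ω * (u - t))) t := by
    refine ((((hZ t).const_mul ω).mul (hphase t).cos).add
      ((hZ' t).mul (hphase t).sin)).congr_deriv ?_
    ring
  have hbound (t : ℝ) (ht : t ∈ s) : ‖r t * sin (ω * (u - t))‖ ≤ C := by
    rw [norm_mul, norm_eq_abs, norm_eq_abs]
    exact (mul_le_of_le_one_right (abs_nonneg _) (abs_sin_le_one _)).trans (hr t ht)
  simpa using hs.norm_image_sub_le_of_norm_hasDerivWithin_le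
    (fun t _ => (hderiv t).hasDerivWithinAt) hbound hv hu

theorem abs_mul_le_half_add_sq (a b : ℝ) : |a * b| ≤ (a ^ 2 + b ^ 2) / 2 := by
  rw [abs_le]
  constructor <;> nlinarith [sq_nonneg (a + b), sq_nonneg (a - b)]

theorem sum_Icc_sub_add_one {G : Type*} [AddCommGroup G] (ψ : ℤ → G) {a b : ℤ}
    (hab : a ≤ b + 1) :
    ∑ k ∈ Finset.Icc a b, (ψ k - ψ (k + 1)) = ψ a - ψ (b + 1) := by
  obtain ⟨n, hn⟩ := Int.le.dest hab
  obtain rfl : b = a + n - 1 := by omega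
  clear hab hn
  induction n with
  | zero => simp
  | succ n ih =>
    rw [show a + ((n + 1 : ℕ) : ℤ) - 1 = a + n - 1 + 1 by push_cast; ring,
      ← Order.succ_eq_add_one (a + n - 1), ← Finset.insert_Icc_right_eq_Icc_succ
      (by rw [Order.succ_eq_add_one]; omega), Finset.sum_insert (by simp), ih,
      Order.succ_eq_add_one]
    abel

theorem abs_sum_sub_add_one_mul_le {ψ : ℤ → ℝ} (hψ : Antitone ψ) (h0 : ∀ k, 0 ≤ ψ k)
    (h1 : ∀ k, ψ k ≤ 1) {g : ℤ → ℝ} {a b : ℤ} {D : ℝ} (hD : 0 ≤ D)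
    (hg : ∀ k ∈ Finset.Icc a b, |g k| ≤ D) :
    |∑ k ∈ Finset.Icc a b, (ψ k - ψ (k + 1)) * g k| ≤ D := by
  rcases le_or_gt a (b + 1) with hab | hab
  · calc |∑ k ∈ Finset.Icc a b, (ψ k - ψ (k + 1)) * g k|
        ≤ ∑ k ∈ Finset.Icc a b, (ψ k - ψ (k + 1)) * D := by
          refine (Finset.abs_sum_le_sum_abs _ _).trans (Finset.sum_le_sum fun k hk => ?_)
          have hk0 : 0 ≤ ψ k - ψ (k + 1) := sub_nonneg.2 (hψ (by lia))
          rw [abs_mul, abs_of_nonneg hk0]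
          exact mul_le_mul_of_nonneg_left (hg k hk) hk0
      _ = (ψ a - ψ (b + 1)) * D := by rw [← Finset.sum_mul, sum_Icc_sub_add_one ψ hab]
      _ ≤ D := mul_le_of_le_one_left hD (by linarith [h1 a, h0 (b + 1)])
  · simpa [Finset.Icc_eq_empty (show ¬ a ≤ b by omega)] using hD

/-! ### Hermite functions and their projection kernels -/

theorem contDiff_gaussian {n : WithTop ℕ∞} : ContDiff ℝ n fun t : ℝ => exp (-t ^ 2) := by
  fun_prop

theorem hasDerivAt_iteratedDeriv_gaussian (n : ℕ) (x : ℝ) :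
    HasDerivAt (iteratedDeriv n fun t : ℝ => exp (-t ^ 2))
      (iteratedDeriv (n + 1) (fun t : ℝ => exp (-t ^ 2)) x) x := by
  rw [iteratedDeriv_succ]
  exact (contDiff_gaussian.differentiable_iteratedDeriv n (WithTop.coe_lt_top _) x).hasDerivAt

theorem iteratedDeriv_gaussian_one (x : ℝ) :
    iteratedDeriv 1 (fun t : ℝ => exp (-t ^ 2)) x = -2 * x * exp (-x ^ 2) := by
  have h : HasDerivAt (fun t : ℝ => exp (-t ^ 2)) (exp (-x ^ 2) * (-(2 * x))) x := by
    simpa using (hasDerivAt_pow 2 x).neg.exp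
  rw [iteratedDeriv_one, h.deriv]
  ring

theorem iteratedDeriv_gaussian_add_two (n : ℕ) (x : ℝ) :
    iteratedDeriv (n + 2) (fun t : ℝ => exp (-t ^ 2)) x =
      -2 * x * iteratedDeriv (n + 1) (fun t : ℝ => exp (-t ^ 2)) x -
        2 * (n + 1) * iteratedDeriv n (fun t : ℝ => exp (-t ^ 2)) x := by
  have hlin := (hasDerivAt_id x).const_mul (-2)
  induction n generalizing x with
  | zero =>
    have hone : iteratedDeriv 1 (fun t : ℝ => exp (-t ^ 2)) =
        fun x => -2 * x * iteratedDeriv 0 (fun t : ℝ => exp (-t ^ 2)) x := by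
      ext y
      rw [iteratedDeriv_gaussian_one, iteratedDeriv_zero]
    have h := hasDerivAt_iteratedDeriv_gaussian 1 x
    rw [hone] at h
    have := h.unique (hlin.mul (hasDerivAt_iteratedDeriv_gaussian 0 x))
    simp only [id_eq] at this
    norm_num at this ⊢
    rw [this]
    ring
  | succ n ih =>
    have h := hasDerivAt_iteratedDeriv_gaussian (n + 2) x
    rw [funext fun y => ih y ((hasDerivAt_id y).const_mul (-2))] at h
    have := h.unique ((hlin.mul (hasDerivAt_iteratedDeriv_gaussian (n + 1) x)).sub
      ((hasDerivAt_iteratedDeriv_gaussian n x).const_mul (2 * ((n : ℝ) + 1))))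
    simp only [id_eq] at this
    rw [show n + 1 + 2 = n + 2 + 1 from rfl, this]
    push_cast
    ring

/-- The coefficient `√(2(n + 1))` of the ladder relations between `h_n` and `h_{n+1}`. -/
def ladderCoeff (n : ℕ) : ℝ := √(2 * (n + 1))

theorem ladderCoeff_pos (n : ℕ) : 0 < ladderCoeff n := by unfold ladderCoeff; positivity

theorem ladderCoeff_sq (n : ℕ) : ladderCoeff n ^ 2 = 2 * (n + 1) := sq_sqrt (by positivity)

theorem ladderCoeff_le (n : ℕ) : ladderCoeff n ≤ 2 * (n + 1) := by
  nlinarith [ladderCoeff_sq n, ladderCoeff_pos n, (Nat.cast_nonneg n : (0 : ℝ) ≤ n)]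

theorem sqrt_hermite_normalization_succ (n : ℕ) :
    √(((n + 1).factorial : ℝ) * 2 ^ (n + 1) * √π) =
      ladderCoeff n * √((n.factorial : ℝ) * 2 ^ n * √π) := by
  rw [ladderCoeff, ← sqrt_mul (by positivity), Nat.factorial_succ]
  congr 1
  push_cast
  ring

theorem hasDerivAt_hermiteFun (n : ℕ) (x : ℝ) :
    HasDerivAt (hermiteFun n) (x * hermiteFun n x - ladderCoeff n * hermiteFun (n + 1) x) x := by
  have hexp : HasDerivAt (fun x : ℝ => exp (x ^ 2 / 2)) (exp (x ^ 2 / 2) * x) x := by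
    simpa using ((hasDerivAt_pow 2 x).div_const 2).exp
  have : 0 < √((n.factorial : ℝ) * 2 ^ n * √π) := by positivity
  have := ladderCoeff_pos n
  have h : HasDerivAt (hermiteFun n) _ x :=
    (hexp.mul_const ((-1) ^ n / √((n.factorial : ℝ) * 2 ^ n * √π))).mul
      (hasDerivAt_iteratedDeriv_gaussian n x)
  refine h.congr_deriv ?_
  simp only [hermiteFun, sqrt_hermite_normalization_succ]
  field_simp
  ring

theorem continuous_hermiteFun (n : ℕ) : Continuous (hermiteFun n) :=
  continuous_iff_continuousAt.2 fun x => (hasDerivAt_hermiteFun n x).continuousAt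

theorem hermiteFun_add_two (n : ℕ) (x : ℝ) :
    ladderCoeff (n + 1) * hermiteFun (n + 2) x =
      2 * x * hermiteFun (n + 1) x - ladderCoeff n * hermiteFun n x := by
  have : 0 < √((n.factorial : ℝ) * 2 ^ n * √π) := by positivity
  have := ladderCoeff_pos n
  have := ladderCoeff_pos (n + 1)
  simp only [hermiteFun, sqrt_hermite_normalization_succ, iteratedDeriv_gaussian_add_two]
  field_simp
  rw [ladderCoeff_sq]
  ring

theorem hermiteFun_one (x : ℝ) : ladderCoeff 0 * hermiteFun 1 x = 2 * x * hermiteFun 0 x := by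
  have : 0 < √√π := by positivity
  have := ladderCoeff_pos 0
  have hsucc := sqrt_hermite_normalization_succ 0
  simp only [zero_add, Nat.factorial_zero, pow_zero, Nat.cast_one, one_mul] at hsucc
  simp only [hermiteFun, hsucc, iteratedDeriv_gaussian_one, iteratedDeriv_zero, pow_zero,
    Nat.factorial_zero, Nat.cast_one, one_mul]
  field_simp

theorem hasDerivAt_hermiteFun_succ (n : ℕ) (x : ℝ) :
    HasDerivAt (hermiteFun (n + 1))
      (ladderCoeff n * hermiteFun n x - x * hermiteFun (n + 1) x) x := by
  refine (hasDerivAt_hermiteFun (n + 1) x).congr_deriv ?_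
  rw [hermiteFun_add_two]
  ring

theorem hasDerivAt_deriv_hermiteFun (n : ℕ) (x : ℝ) :
    HasDerivAt (fun t => t * hermiteFun n t - ladderCoeff n * hermiteFun (n + 1) t)
      ((x ^ 2 - (2 * n + 1)) * hermiteFun n x) x := by
  refine (((hasDerivAt_id x).mul (hasDerivAt_hermiteFun n x)).sub
    ((hasDerivAt_hermiteFun_succ n x).const_mul (ladderCoeff n))).congr_deriv ?_
  simp only [id_eq]
  linear_combination -hermiteFun n x * ladderCoeff_sq n

/-- The Christoffel–Darboux kernel `∑_{j<M} h_j(u) h_j(v)` of the Hermite functions: the projection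
onto the first `M` of them. -/
def hermiteKernel (M : ℕ) (u v : ℝ) : ℝ :=
  ∑ j ∈ Finset.range M, hermiteFun j u * hermiteFun j v

theorem hermiteKernel_succ (M : ℕ) (u v : ℝ) :
    hermiteKernel (M + 1) u v = hermiteKernel M u v + hermiteFun M u * hermiteFun M v :=
  Finset.sum_range_succ _ _

theorem hermiteKernel_self_nonneg (M : ℕ) (v : ℝ) : 0 ≤ hermiteKernel M v v :=
  Finset.sum_nonneg fun _ _ => mul_self_nonneg _

theorem christoffelDarboux (n : ℕ) (u v : ℝ) :
    (u - v) * hermiteKernel (n + 1) u v = ladderCoeff n / 2 *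
      (hermiteFun (n + 1) u * hermiteFun n v - hermiteFun n u * hermiteFun (n + 1) v) := by
  induction n with
  | zero =>
    rw [hermiteKernel, Finset.sum_range_one]
    linear_combination
      hermiteFun 0 u * hermiteFun_one v / 2 - hermiteFun 0 v * hermiteFun_one u / 2
  | succ n ih =>
    rw [hermiteKernel_succ, mul_add, ih]
    linear_combination hermiteFun (n + 1) u * hermiteFun_add_two n v / 2 -
      hermiteFun (n + 1) v * hermiteFun_add_two n u / 2

theorem hermiteKernel_self (n : ℕ) (v : ℝ) :
    hermiteKernel (n + 1) v v =
      ladderCoeff n ^ 2 / 2 * (hermiteFun (n + 1) v ^ 2 + hermiteFun n v ^ 2) -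
        ladderCoeff n * v * hermiteFun (n + 1) v * hermiteFun n v := by
  induction n with
  | zero =>
    have hsq : ladderCoeff 0 ^ 2 = 2 := by simp [ladderCoeff_sq]
    rw [hermiteKernel, Finset.sum_range_one, zero_add]
    linear_combination (-ladderCoeff 0 * hermiteFun 1 v / 2) * hermiteFun_one v -
      hermiteFun 0 v ^ 2 * hsq / 2
  | succ n ih =>
    have hrec := hermiteFun_add_two n v
    have hsq : ladderCoeff (n + 1) ^ 2 = ladderCoeff n ^ 2 + 2 := by
      simp only [ladderCoeff_sq]
      push_cast
      ring
    rw [hermiteKernel_succ, ih]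
    linear_combination (-(ladderCoeff (n + 1) * hermiteFun (n + 2) v + (2 * v * hermiteFun (n + 1) v
      - ladderCoeff n * hermiteFun n v)) / 2 + v * hermiteFun (n + 1) v) * hrec
      - hermiteFun (n + 1) v ^ 2 / 2 * hsq

theorem hermiteFun_add_two_zero_sq (n : ℕ) :
    hermiteFun (n + 2) 0 ^ 2 = ((n : ℝ) + 1) / (n + 2) * hermiteFun n 0 ^ 2 := by
  have hrec : ladderCoeff (n + 1) ^ 2 * hermiteFun (n + 2) 0 ^ 2 =
      ladderCoeff n ^ 2 * hermiteFun n 0 ^ 2 := by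
    rw [← mul_pow, hermiteFun_add_two]
    ring
  simp only [ladderCoeff_sq] at hrec
  push_cast at hrec
  field_simp
  linarith

theorem hermiteFun_odd_zero (j : ℕ) : hermiteFun (2 * j + 1) 0 = 0 := by
  induction j with
  | zero => simpa [(ladderCoeff_pos 0).ne'] using hermiteFun_one 0
  | succ j ih =>
    have h := hermiteFun_add_two_zero_sq (2 * j + 1)
    rw [ih] at h
    simpa [show 2 * (j + 1) + 1 = 2 * j + 1 + 2 by ring] using h

theorem hermiteFun_even_zero_pow_four (j : ℕ) :
    hermiteFun (2 * j) 0 ^ 4 * ((2 * j + 1) * Wallis.W j) = 1 / π := by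
  have hfour (k : ℕ) : hermiteFun k 0 ^ 4 = (hermiteFun k 0 ^ 2) ^ 2 := by ring
  induction j with
  | zero =>
    have hzero : hermiteFun 0 0 ^ 2 = 1 / √π := by simp [hermiteFun, sq_sqrt]
    rw [mul_zero, hfour, hzero, div_pow, sq_sqrt pi_pos.le]
    simp [Wallis.W]
  | succ j ih =>
    rw [← ih, Wallis.W_succ, mul_add_one, hfour, hermiteFun_add_two_zero_sq]
    push_cast
    field_simp
    ring

theorem hermiteKernel_zero_odd_sq_mem_Icc (j : ℕ) :
    π ^ 2 / 2 * hermiteKernel (2 * j + 1) 0 0 ^ 2 ∈ Set.Icc (2 * (j : ℝ) + 1) (2 * j + 2) := by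
  have hW := Wallis.W_pos j
  have hle := Wallis.W_le j
  have hge := Wallis.le_W j
  have heq : π ^ 2 / 2 * hermiteKernel (2 * j + 1) 0 0 ^ 2 =
      (2 * j + 1) * (π / 2 / Wallis.W j) := by
    have h := hermiteFun_even_zero_pow_four j
    rw [← eq_div_iff (by positivity)] at h
    rw [hermiteKernel_self, hermiteFun_odd_zero, ladderCoeff_sq]
    push_cast
    calc _ = π ^ 2 / 2 * (2 * j + 1) ^ 2 * hermiteFun (2 * j) 0 ^ 4 := by ring
      _ = _ := by rw [h]; field_simp
  rw [heq]
  constructor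
  · exact le_mul_of_one_le_right (by positivity) ((one_le_div hW).2 hle)
  · rw [← le_div_iff₀' (by positivity), div_le_iff₀ hW]
    rw [div_mul_eq_mul_div, div_le_iff₀ (by positivity)] at hge
    rw [div_mul_eq_mul_div, le_div_iff₀ (by positivity)]
    linarith

theorem hermiteKernel_zero_sq_mem_Icc (n : ℕ) :
    π ^ 2 / 2 * hermiteKernel (n + 1) 0 0 ^ 2 ∈ Set.Icc (n : ℝ) (n + 2) := by
  obtain ⟨j, rfl | rfl⟩ := Nat.even_or_odd' n
  · obtain ⟨hlo, hhi⟩ := hermiteKernel_zero_odd_sq_mem_Icc j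
    push_cast
    constructor <;> linarith
  · obtain ⟨hlo, hhi⟩ := hermiteKernel_zero_odd_sq_mem_Icc j
    rw [hermiteKernel_succ (2 * j + 1), hermiteFun_odd_zero, zero_mul, add_zero]
    push_cast
    constructor <;> linarith

theorem hermiteKernel_zero_le (n : ℕ) : hermiteKernel (n + 1) 0 0 ≤ ladderCoeff n / 2 := by
  refine le_of_sq_le_sq ?_ (by linarith [ladderCoeff_pos n])
  have hS := (hermiteKernel_zero_sq_mem_Icc n).2
  rw [div_pow, ladderCoeff_sq]
  have hpi : 9 / 2 ≤ π ^ 2 / 2 := by nlinarith [pi_gt_three]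
  linarith [mul_le_mul_of_nonneg_right hpi (sq_nonneg (hermiteKernel (n + 1) 0 0))]

theorem abs_hermiteKernel_zero_sub_le {n : ℕ} {ω : ℝ} (hω : 0 < ω) (hlo : 2 * (n : ℝ) ≤ ω ^ 2)
    (hhi : ω ^ 2 ≤ 2 * (n + 1)) : |hermiteKernel (n + 1) 0 0 - ω / π| ≤ 4 / ω := by
  set S := hermiteKernel (n + 1) 0 0
  have hS0 : 0 ≤ S := hermiteKernel_self_nonneg _ _
  obtain ⟨h1, h2⟩ := hermiteKernel_zero_sq_mem_Icc n
  have hprod : |π * S - ω| * ω ≤ 4 := calc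
    |π * S - ω| * ω ≤ |π * S - ω| * |π * S + ω| := by
        gcongr
        exact le_trans (by nlinarith [pi_pos]) (le_abs_self _)
    _ = |(π * S) ^ 2 - ω ^ 2| := by rw [← abs_mul]; ring_nf
    _ ≤ 4 := by rw [abs_le]; constructor <;> linarith [mul_pow π S 2]
  have hdiv : S - ω / π = (π * S - ω) / π := by field_simp
  rw [hdiv, abs_div, abs_of_pos pi_pos]
  calc |π * S - ω| / π ≤ |π * S - ω| := div_le_self (abs_nonneg _) (by linarith [pi_gt_three])
    _ ≤ 4 / ω := (le_div_iff₀ hω).2 hprod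

theorem hasDerivAt_hermiteKernel_self_add (n : ℕ) (v : ℝ) :
    HasDerivAt (fun v => hermiteKernel (n + 1) v v + hermiteFun (n + 1) v ^ 2 / 2)
      (-v * hermiteFun (n + 1) v ^ 2) v := by
  have hp := hasDerivAt_hermiteFun_succ n v
  have hq := hasDerivAt_hermiteFun n v
  simp only [hermiteKernel_self]
  refine (((((hp.pow 2).add (hq.pow 2)).const_mul (ladderCoeff n ^ 2 / 2)).sub
    ((((hasDerivAt_id v).const_mul (ladderCoeff n)).mul hp).mul hq)).add
      ((hp.pow 2).div_const 2)).congr_deriv ?_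
  simp only [id_eq, Pi.mul_apply, Nat.add_one_sub_one, pow_one]
  push_cast
  ring

theorem hermiteKernel_self_le (n : ℕ) (v : ℝ) : hermiteKernel (n + 1) v v ≤ ladderCoeff n := by
  have hmax := apply_le_apply_zero_of_hasDerivAt (hasDerivAt_hermiteKernel_self_add n)
    (fun _ => sq_nonneg _) v
  have hsq : hermiteFun (n + 1) 0 ^ 2 ≤ hermiteKernel (n + 1) 0 0 := by
    rw [hermiteKernel_self, ladderCoeff_sq]
    nlinarith [sq_nonneg (hermiteFun (n + 1) 0), sq_nonneg (hermiteFun n 0),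
      (n.cast_nonneg : (0 : ℝ) ≤ n)]
  linarith [hermiteKernel_zero_le n, sq_nonneg (hermiteFun (n + 1) v), ladderCoeff_pos n]

theorem hermiteFun_sq_le (n : ℕ) (v : ℝ) : hermiteFun n v ^ 2 ≤ ladderCoeff n := by
  have h := hermiteKernel_self_le n v
  rw [hermiteKernel_succ, ← sq] at h
  linarith [hermiteKernel_self_nonneg n v]

theorem abs_hermiteFun_mul_le (n : ℕ) (u v : ℝ) :
    |hermiteFun n u * hermiteFun n v| ≤ 2 * (n + 1) := by
  linarith [abs_mul_le_half_add_sq (hermiteFun n u) (hermiteFun n v), hermiteFun_sq_le n u,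
    hermiteFun_sq_le n v, ladderCoeff_le n]

theorem hermiteFun_sq_add_sq_le {n : ℕ} {v : ℝ} (hv : |v| ≤ ladderCoeff n / 2) :
    hermiteFun (n + 1) v ^ 2 + hermiteFun n v ^ 2 ≤ 4 / ladderCoeff n := by
  have hdiag := hermiteKernel_self_le n v
  have hb := ladderCoeff_pos n
  rw [hermiteKernel_self] at hdiag
  set b := ladderCoeff n
  set p := hermiteFun (n + 1) v
  set q := hermiteFun n v
  have hcross : v * (p * q) ≤ b / 2 * ((p ^ 2 + q ^ 2) / 2) := calc
    v * (p * q) ≤ |v| * |p * q| := (le_abs_self _).trans (abs_mul _ _).le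
    _ ≤ _ := by gcongr; exact abs_mul_le_half_add_sq p q
  have hfactored : b * ((p ^ 2 + q ^ 2) * b) ≤ b * 4 := by nlinarith
  exact (le_div_iff₀ hb).2 (le_of_mul_le_mul_left hfactored hb)

theorem hermiteFun_succ_sq_le {n : ℕ} {v : ℝ} (hv : |v| ≤ ladderCoeff n / 2) :
    hermiteFun (n + 1) v ^ 2 ≤ 4 / ladderCoeff n :=
  (le_add_of_nonneg_right (sq_nonneg _)).trans (hermiteFun_sq_add_sq_le hv)

theorem abs_hermiteKernel_self_sub_zero_le {n : ℕ} {v X : ℝ} (hv : |v| ≤ X)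
    (hX : X ≤ ladderCoeff n / 2) :
    |hermiteKernel (n + 1) v v - hermiteKernel (n + 1) 0 0| ≤ (4 * X ^ 2 + 4) / ladderCoeff n := by
  have hX0 : 0 ≤ X := (abs_nonneg v).trans hv
  have hb := ladderCoeff_pos n
  have hbound (t : ℝ) (ht : t ∈ Set.Icc (-X) X) :
      ‖-t * hermiteFun (n + 1) t ^ 2‖ ≤ X * (4 / ladderCoeff n) := by
    have ht' : |t| ≤ X := abs_le.2 ht
    rw [norm_mul, norm_neg, norm_eq_abs, norm_of_nonneg (sq_nonneg _)]
    gcongr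
    exact hermiteFun_succ_sq_le (ht'.trans hX)
  have hmvt := (convex_Icc (-X) X).norm_image_sub_le_of_norm_hasDerivWithin_le
    (fun t _ => (hasDerivAt_hermiteKernel_self_add n t).hasDerivWithinAt) hbound
    (show (0 : ℝ) ∈ _ by simp [hX0]) (show v ∈ _ from abs_le.1 hv)
  rw [norm_eq_abs, norm_eq_abs, sub_zero] at hmvt
  have hvX := hmvt.trans (mul_le_mul_of_nonneg_left hv (by positivity))
  have hpv := hermiteFun_succ_sq_le (hv.trans hX)
  have hp0 := hermiteFun_succ_sq_le (n := n) (v := 0) (by rw [abs_zero]; positivity)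
  have hsplit : (4 * X ^ 2 + 4) / ladderCoeff n =
      X * (4 / ladderCoeff n) * X + 4 / ladderCoeff n := by ring
  rw [hsplit]
  rw [abs_le] at hvX ⊢
  constructor <;> linarith [sq_nonneg (hermiteFun (n + 1) v), sq_nonneg (hermiteFun (n + 1) 0)]

/-! ### Sine kernel asymptotics -/

theorem abs_hermite_forcing_le {n : ℕ} {t v X ω : ℝ} (ht : |t| ≤ X) (hv : |v| ≤ X)
    (hX : X ≤ ladderCoeff n / 2) (hlo : 2 * (n : ℝ) ≤ ω ^ 2) (hhi : ω ^ 2 ≤ 2 * (n + 1)) :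
    |(t ^ 2 + ω ^ 2 - (2 * (n + 1) + 1)) * (hermiteFun (n + 1) t * hermiteFun n v) -
      (t ^ 2 + ω ^ 2 - (2 * n + 1)) * (hermiteFun n t * hermiteFun (n + 1) v)| ≤
      (X ^ 2 + 3) * (4 / ladderCoeff n) := by
  have htt := hermiteFun_sq_add_sq_le (ht.trans hX)
  have hvv := hermiteFun_sq_add_sq_le (hv.trans hX)
  have hsq : t ^ 2 ≤ X ^ 2 := sq_le_sq.2 (ht.trans (le_abs_self X))
  have hpot₁ : |t ^ 2 + ω ^ 2 - (2 * (n + 1) + 1)| ≤ X ^ 2 + 3 := by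
    rw [abs_le]; constructor <;> linarith [sq_nonneg t, sq_nonneg X]
  have hpot₀ : |t ^ 2 + ω ^ 2 - (2 * n + 1)| ≤ X ^ 2 + 3 := by
    rw [abs_le]; constructor <;> linarith [sq_nonneg t, sq_nonneg X]
  refine (abs_sub _ _).trans ?_
  rw [abs_mul _ (_ * _), abs_mul _ (_ * _)]
  calc _ ≤ (X ^ 2 + 3) * ((hermiteFun (n + 1) t ^ 2 + hermiteFun n v ^ 2) / 2) +
        (X ^ 2 + 3) * ((hermiteFun n t ^ 2 + hermiteFun (n + 1) v ^ 2) / 2) := by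
        gcongr <;> exact abs_mul_le_half_add_sq _ _
    _ = (X ^ 2 + 3) * ((hermiteFun (n + 1) t ^ 2 + hermiteFun n t ^ 2 +
          (hermiteFun (n + 1) v ^ 2 + hermiteFun n v ^ 2)) / 2) := by ring
    _ ≤ _ := mul_le_mul_of_nonneg_left (by linarith) (by positivity)

/- The numerator of the Christoffel–Darboux formula, as a function of `u`, solves the oscillator
equation with frequency `ω` up to a bounded forcing, vanishes at `u = v`, and has slope
`2 S(v, v) / b_n` there. -/
theorem abs_sub_mul_hermiteKernel_sub_sin_le {n : ℕ} {u v X ω : ℝ} (hu : |u| ≤ X) (hv : |v| ≤ X)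
    (hX : X ≤ ladderCoeff n / 2) (hlo : 2 * (n : ℝ) ≤ ω ^ 2) (hhi : ω ^ 2 ≤ 2 * (n + 1)) :
    |ω * ((u - v) * hermiteKernel (n + 1) u v) -
      hermiteKernel (n + 1) v v * sin (ω * (u - v))| ≤ (2 * X ^ 2 + 6) * |u - v| := by
  have hb := ladderCoeff_pos n
  have hcd := christoffelDarboux n u v
  set p := hermiteFun (n + 1)
  set q := hermiteFun n
  have hZ (t : ℝ) : HasDerivAt (fun t => p t * q v - q t * p v)
      ((t * p t - ladderCoeff (n + 1) * hermiteFun (n + 2) t) * q v -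
        (t * q t - ladderCoeff n * p t) * p v) t :=
    ((hasDerivAt_hermiteFun (n + 1) t).mul_const _).sub ((hasDerivAt_hermiteFun n t).mul_const _)
  have hZ' (t : ℝ) : HasDerivAt
      (fun t => (t * p t - ladderCoeff (n + 1) * hermiteFun (n + 2) t) * q v -
        (t * q t - ladderCoeff n * p t) * p v)
      ((t ^ 2 + ω ^ 2 - (2 * (n + 1) + 1)) * (p t * q v) -
        (t ^ 2 + ω ^ 2 - (2 * n + 1)) * (q t * p v) - ω ^ 2 * (p t * q v - q t * p v)) t := by
    refine (((hasDerivAt_deriv_hermiteFun (n + 1) t).mul_const _).sub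
      ((hasDerivAt_deriv_hermiteFun n t).mul_const _)).congr_deriv ?_
    push_cast
    ring
  have hosc := abs_sub_harmonic_le (convex_Icc (-X) X) hZ hZ'
    (fun t ht => abs_hermite_forcing_le (abs_le.2 ht) hv hX hlo hhi) (abs_le.1 hu) (abs_le.1 hv)
  have hslope : ladderCoeff n / 2 * ((v * p v - ladderCoeff (n + 1) * hermiteFun (n + 2) v) * q v -
      (v * q v - ladderCoeff n * p v) * p v) = hermiteKernel (n + 1) v v := by
    rw [hermiteFun_add_two, hermiteKernel_self]
    ring
  calc _ = |ladderCoeff n / 2 * (ω * (p u * q v - q u * p v) -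
        (ω * (p v * q v - q v * p v) * cos (ω * (u - v)) +
          ((v * p v - ladderCoeff (n + 1) * hermiteFun (n + 2) v) * q v -
            (v * q v - ladderCoeff n * p v) * p v) * sin (ω * (u - v))))| := by
        rw [hcd, ← hslope]
        ring_nf
    _ ≤ ladderCoeff n / 2 * ((X ^ 2 + 3) * (4 / ladderCoeff n) * |u - v|) := by
        rw [abs_mul, abs_of_pos (half_pos hb)]
        gcongr
    _ = _ := by field_simp; ring

theorem abs_hermiteKernel_sub_self_mul_sinc_le {n : ℕ} {u v X ω : ℝ} (hu : |u| ≤ X) (hv : |v| ≤ X)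
    (hX : X ≤ ladderCoeff n / 2) (hω : 0 < ω) (hlo : 2 * (n : ℝ) ≤ ω ^ 2)
    (hhi : ω ^ 2 ≤ 2 * (n + 1)) :
    |hermiteKernel (n + 1) u v - hermiteKernel (n + 1) v v * sinc (ω * (u - v))| ≤
      (2 * X ^ 2 + 6) / ω := by
  rcases eq_or_ne u v with rfl | huv
  · rw [sub_self, mul_zero, sinc_zero, mul_one, sub_self, abs_zero]
    positivity
  have hd : u - v ≠ 0 := sub_ne_zero.2 huv
  have h := abs_sub_mul_hermiteKernel_sub_sin_le hu hv hX hlo hhi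
  have hfactor : ω * ((u - v) * hermiteKernel (n + 1) u v) -
      hermiteKernel (n + 1) v v * sin (ω * (u - v)) =
      (hermiteKernel (n + 1) u v - hermiteKernel (n + 1) v v * sinc (ω * (u - v))) * ω *
        (u - v) := by
    rw [sinc_of_ne_zero (mul_ne_zero hω.ne' hd)]
    field_simp
  rw [hfactor, abs_mul, abs_mul, abs_of_pos hω] at h
  exact (le_div_iff₀ hω).2 (le_of_mul_le_mul_right h (abs_pos.2 hd))

theorem abs_hermiteKernel_sub_sinc_le {n : ℕ} {u v X ω : ℝ} (hu : |u| ≤ X) (hv : |v| ≤ X)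
    (hX : X ≤ ladderCoeff n / 2) (hω : 0 < ω) (hlo : 2 * (n : ℝ) ≤ ω ^ 2)
    (hhi : ω ^ 2 ≤ 2 * (n + 1)) :
    |hermiteKernel (n + 1) u v - ω / π * sinc (ω * (u - v))| ≤ (6 * X ^ 2 + 14) / ω := by
  have hωb : ω ≤ ladderCoeff n := le_sqrt_of_sq_le hhi
  have hvar := abs_hermiteKernel_self_sub_zero_le hv hX
  have hdensity : |hermiteKernel (n + 1) v v - ω / π| ≤ (4 * X ^ 2 + 8) / ω := calc
    |hermiteKernel (n + 1) v v - ω / π|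
      ≤ (4 * X ^ 2 + 4) / ladderCoeff n + 4 / ω :=
        (abs_sub_le _ _ _).trans (add_le_add hvar (abs_hermiteKernel_zero_sub_le hω hlo hhi))
    _ ≤ (4 * X ^ 2 + 4) / ω + 4 / ω := by gcongr
    _ = _ := by ring
  calc |hermiteKernel (n + 1) u v - ω / π * sinc (ω * (u - v))|
      = |(hermiteKernel (n + 1) u v - hermiteKernel (n + 1) v v * sinc (ω * (u - v))) +
          (hermiteKernel (n + 1) v v - ω / π) * sinc (ω * (u - v))| := by ring_nf
    _ ≤ (2 * X ^ 2 + 6) / ω + (4 * X ^ 2 + 8) / ω * 1 := by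
        refine (abs_add_le _ _).trans (add_le_add
          (abs_hermiteKernel_sub_self_mul_sinc_le hu hv hX hω hlo hhi) ?_)
        rw [abs_mul]
        gcongr
        exact abs_sinc_le_one _
    _ = _ := by ring

/-! ### Mixtures with exponentially small tails -/

/-- An antitone profile with values in `[0, 1]` that approaches its limits `1` at `-∞` and `0` at
`+∞` exponentially fast, with rate `β` and constant `C`. No smoothness is required, so that the
unit step `𝟙(x ≤ 0)` is an example as well. -/
structure IsExpTailed (ψ : ℝ → ℝ) (β C : ℝ) : Prop where
  rate_pos : 0 < β
  antitone : Antitone ψ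
  nonneg : ∀ x, 0 ≤ ψ x
  le_one : ∀ x, ψ x ≤ 1
  le_exp : ∀ x, ψ x ≤ C * exp (-β * x)
  one_sub_le_exp : ∀ x, 1 - ψ x ≤ C * exp (β * x)

namespace IsExpTailed

variable {ψ : ℝ → ℝ} {β C : ℝ}

theorem const_pos (hψ : IsExpTailed ψ β C) : 0 < C := by
  have h0 := hψ.le_exp 0
  have h1 := hψ.one_sub_le_exp 0
  simp only [mul_zero, exp_zero, mul_one] at h0 h1
  linarith

theorem comp_div (hψ : IsExpTailed ψ β C) {σ : ℝ} (hσ : 0 < σ) :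
    IsExpTailed (fun t => ψ (t / σ)) (β / σ) C where
  rate_pos := div_pos hψ.rate_pos hσ
  antitone _ _ hxy := hψ.antitone (by gcongr)
  nonneg _ := hψ.nonneg _
  le_one _ := hψ.le_one _
  le_exp x := (hψ.le_exp _).trans_eq (by ring_nf)
  one_sub_le_exp x := (hψ.one_sub_le_exp _).trans_eq (by ring_nf)

end IsExpTailed

/-- The weight `∑_{|k| ≤ B, m ≤ k} (ψ(k) - ψ(k + 1))` of the index `m` in the mixture of the
projections `𝟙(m ≤ k)`, `|k| ≤ B`, with weights the increments of `ψ`. -/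
def cutoffWeight (ψ : ℝ → ℝ) (B m : ℤ) : ℝ :=
  ∑ k ∈ Finset.Icc (-B) B with m ≤ k, (ψ k - ψ (k + 1))

theorem cutoffWeight_of_lt (ψ : ℝ → ℝ) {B m : ℤ} (hm : B < m) : cutoffWeight ψ B m = 0 :=
  Finset.sum_eq_zero fun k hk => by
    rw [Finset.mem_filter, Finset.mem_Icc] at hk
    omega

theorem cutoffWeight_of_le (ψ : ℝ → ℝ) {B m : ℤ} (hB : 0 ≤ B) (hm : m ≤ B) :
    cutoffWeight ψ B m = ψ (max m (-B) : ℤ) - ψ (B + 1) := by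
  have hfilter : (Finset.Icc (-B) B).filter (m ≤ ·) = Finset.Icc (max m (-B)) B := by
    ext k
    simp only [Finset.mem_filter, Finset.mem_Icc]
    omega
  rw [cutoffWeight, hfilter]
  exact_mod_cast sum_Icc_sub_add_one (fun k : ℤ => ψ k) (show max m (-B) ≤ B + 1 by omega)

theorem hasSum_cutoffWeight_mul (ψ : ℝ → ℝ) (B : ℤ) (n : ℕ) (a : ℕ → ℝ) :
    HasSum (fun j : ℕ => cutoffWeight ψ B (j - n) * a j)
      (∑ k ∈ Finset.Icc (-B) B,
        (ψ k - ψ (k + 1)) * ∑ j ∈ Finset.range (n + 1 + k).toNat, a j) := by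
  have hterm (k : ℤ) : HasSum (fun j : ℕ => if (j - n : ℤ) ≤ k then (ψ k - ψ (k + 1)) * a j else 0)
      ((ψ k - ψ (k + 1)) * ∑ j ∈ Finset.range (n + 1 + k).toNat, a j) := by
    have hmem (j : ℕ) : (j - n : ℤ) ≤ k ↔ j ∈ Finset.range (n + 1 + k).toNat := by
      rw [Finset.mem_range]
      omega
    simp_rw [hmem, Finset.mul_sum]
    have h := hasSum_sum_of_ne_finset_zero (L := .unconditional ℕ)
      (f := fun j => if j ∈ Finset.range (n + 1 + k).toNat then (ψ k - ψ (k + 1)) * a j else 0)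
      fun _ hj => if_neg hj
    rwa [Finset.sum_ite_mem, Finset.inter_self] at h
  refine (hasSum_sum fun k _ => hterm k).congr_fun fun j => ?_
  rw [cutoffWeight, Finset.sum_mul, Finset.sum_filter]

theorem IsExpTailed.abs_sub_cutoffWeight_le {ψ : ℝ → ℝ} {β C : ℝ} (hψ : IsExpTailed ψ β C)
    {B m : ℤ} (hB : 0 ≤ B) {t : ℝ} (hlt : (m : ℝ) - 1 ≤ t) (htm : t ≤ m) :
    |ψ t - cutoffWeight ψ B m| ≤ (if -B < m then ψ (m - 1) - ψ m else 0) +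
      2 * C * exp (-(β / 2) * B) * exp (-(β / 2) * max ((m : ℝ) - 1) 0) := by
  have hC := hψ.const_pos
  have hβ := hψ.rate_pos
  have hB' : (0 : ℝ) ≤ B := by exact_mod_cast hB
  have hupper := hψ.antitone hlt
  have hlower := hψ.antitone htm
  have htail (x : ℝ) (hx : B + max ((m : ℝ) - 1) 0 ≤ 2 * x) :
      C * exp (-β * x) ≤ C * exp (-(β / 2) * B) * exp (-(β / 2) * max ((m : ℝ) - 1) 0) := by
    rw [mul_assoc, ← exp_add]
    gcongr
    nlinarith
  have hright := hψ.le_exp (B + 1)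
  have hright0 := hψ.nonneg (B + 1)
  rcases lt_or_ge B m with hm | hm
  · have hm' : (B : ℝ) + 1 ≤ m := by exact_mod_cast hm
    have hge := htail (m - 1) (by rw [max_eq_left (by linarith)]; linarith)
    rw [cutoffWeight_of_lt ψ hm, sub_zero, abs_of_nonneg (hψ.nonneg t), if_pos (by omega)]
    linarith [hψ.le_exp (m - 1), hψ.nonneg m]
  have hm' : (m : ℝ) ≤ B := by exact_mod_cast hm
  have hmid := htail (B + 1) (by linarith [max_le (show (m : ℝ) - 1 ≤ B by linarith) hB'])
  rw [cutoffWeight_of_le ψ hB hm]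
  split_ifs with hBm
  · rw [max_eq_left hBm.le, abs_le]
    constructor <;> linarith
  · rw [not_lt] at hBm
    have hBm' : (m : ℝ) ≤ -B := by exact_mod_cast hBm
    have hleft := htail B (by rw [max_eq_right (by linarith)]; linarith)
    have hone := hψ.one_sub_le_exp (-B)
    rw [mul_neg, ← neg_mul] at hone
    rw [max_eq_right hBm, abs_le]
    push_cast
    constructor <;> linarith [hψ.antitone (htm.trans hBm'), hψ.le_one t]

theorem exp_neg_mul_max_mul_cube_le {γ p x : ℝ} (hγ : 0 < γ) (hp : 0 ≤ p) (hx : 0 ≤ x) :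
    exp (-γ * max (x - p) 0) * (x + 1) ^ 3 ≤ 6 * ((p + 1) * (1 + 1 / γ)) ^ 3 := by
  set y := γ * max (x - p) 0 with hy
  have hy0 : 0 ≤ y := by positivity
  have hbase : x + 1 ≤ (p + 1) * (1 + 1 / γ) * (1 + y) := by
    have hmax : y * (1 / γ) = max (x - p) 0 := by rw [hy]; field_simp
    have h1 : 0 ≤ 1 / γ := by positivity
    nlinarith [le_max_left (x - p) 0, mul_nonneg hp (le_max_right (x - p) 0), mul_nonneg hp hy0,
      mul_nonneg hp h1]
  have hexp : (1 + y) ^ 3 ≤ 6 * exp y := by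
    have h := sum_le_exp_of_nonneg hy0 4
    norm_num [Finset.sum_range_succ, Nat.factorial] at h
    linarith
  calc exp (-γ * max (x - p) 0) * (x + 1) ^ 3
      ≤ exp (-γ * max (x - p) 0) * ((p + 1) * (1 + 1 / γ) * (1 + y)) ^ 3 := by gcongr
    _ = exp (-y) * ((p + 1) * (1 + 1 / γ)) ^ 3 * (1 + y) ^ 3 := by rw [hy]; ring_nf
    _ ≤ exp (-y) * ((p + 1) * (1 + 1 / γ)) ^ 3 * (6 * exp y) := by gcongr
    _ = 6 * ((p + 1) * (1 + 1 / γ)) ^ 3 := by rw [exp_neg]; field_simp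

theorem summable_add_one_mul_exp_neg {β : ℝ} (hβ : 0 < β) :
    Summable fun j : ℕ => ((j : ℝ) + 1) * exp (-β * j) := by
  simp only [add_mul, one_mul]
  simpa using (summable_pow_mul_exp_neg_nat_mul 1 hβ).add (summable_pow_mul_exp_neg_nat_mul 0 hβ)

theorem summable_one_div_add_one_sq : Summable fun j : ℕ => 1 / ((j : ℝ) + 1) ^ 2 := by
  exact_mod_cast (summable_nat_add_iff 1).2 (summable_one_div_nat_pow.2 one_lt_two)

theorem tsum_one_div_add_one_sq_le : ∑' j : ℕ, 1 / ((j : ℝ) + 1) ^ 2 ≤ 2 := by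
  have h := hasSum_zeta_two.summable.tsum_eq_zero_add
  rw [hasSum_zeta_two.tsum_eq] at h
  push_cast at h
  norm_num at h ⊢
  rw [← h]
  nlinarith [pi_lt_d2, pi_pos]

theorem summable_and_tsum_sub_add_one_le {ψ : ℕ → ℝ} (hψ : Antitone ψ) (h0 : ∀ j, 0 ≤ ψ j) :
    Summable (fun j => ψ j - ψ (j + 1)) ∧ ∑' j, (ψ j - ψ (j + 1)) ≤ ψ 0 := by
  have hnonneg (j : ℕ) : 0 ≤ ψ j - ψ (j + 1) := sub_nonneg.2 (hψ j.le_succ)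
  have hsum (n : ℕ) : ∑ j ∈ Finset.range n, (ψ j - ψ (j + 1)) ≤ ψ 0 := by
    rw [Finset.sum_range_sub']
    linarith [h0 n]
  exact ⟨summable_of_sum_range_le hnonneg hsum, Real.tsum_le_of_sum_range_le hnonneg hsum⟩

namespace IsExpTailed

variable {ψ : ℝ → ℝ} {β C D : ℝ}

theorem abs_mul_le (hψ : IsExpTailed ψ β C) (N : ℝ) {j : ℕ} {b : ℝ} (hb : |b| ≤ D * (j + 1)) :
    |ψ (j - N) * b| ≤ C * exp (β * N) * D * ((j + 1) * exp (-β * j)) := by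
  rw [abs_mul, abs_of_nonneg (hψ.nonneg _)]
  calc ψ (j - N) * |b| ≤ C * exp (-β * (j - N)) * (D * (j + 1)) := by
        gcongr
        · exact (hψ.nonneg _).trans (hψ.le_exp _)
        · exact hψ.le_exp _
    _ = C * exp (β * N) * D * ((j + 1) * exp (-β * j)) := by
        rw [show -β * (j - N) = β * N + -β * j by ring, exp_add]
        ring

theorem summable_mul (hψ : IsExpTailed ψ β C) (N : ℝ) {a : ℕ → ℝ}
    (ha : ∀ j, |a j| ≤ D * (j + 1)) : Summable fun j : ℕ => ψ (j - N) * a j :=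
  .of_norm_bounded ((summable_add_one_mul_exp_neg hψ.rate_pos).mul_left _)
    fun j => hψ.abs_mul_le N (ha j)

theorem abs_sub_cutoffWeight_mul_le (hψ : IsExpTailed ψ β C) {N κ : ℝ} (hN : 0 ≤ N) {B : ℤ}
    (hB : 0 ≤ B) (hD : 0 ≤ D) {b : ℝ} {j : ℕ} (hb : |b| ≤ D * (j + 1))
    (hbκ : (⌊N⌋₊ : ℤ) < j + B → |b| ≤ κ) (hκ : 0 ≤ κ) :
    |ψ (j - N) * b - cutoffWeight ψ B (j - ⌊N⌋₊) * b| ≤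
      κ * (ψ (j - ⌊N⌋₊ - 1) - ψ (j - ⌊N⌋₊)) +
        12 * C * D * exp (-(β / 2) * B) * ((⌊N⌋₊ + 2) * (1 + 2 / β)) ^ 3 * (1 / (j + 1) ^ 2) := by
  have hβ := hψ.rate_pos
  have hC := hψ.const_pos
  have hweight := hψ.abs_sub_cutoffWeight_le (m := j - ⌊N⌋₊) (t := j - N) hB
    (by push_cast; linarith [Nat.lt_floor_add_one N]) (by push_cast; linarith [Nat.floor_le hN])
  push_cast at hweight
  have hincr : (if -B < (j - ⌊N⌋₊ : ℤ) then ψ (j - ⌊N⌋₊ - 1) - ψ (j - ⌊N⌋₊) else 0) * |b| ≤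
      κ * (ψ (j - ⌊N⌋₊ - 1) - ψ (j - ⌊N⌋₊)) := by
    have hnonneg : 0 ≤ ψ (j - ⌊N⌋₊ - 1) - ψ (j - ⌊N⌋₊) := sub_nonneg.2 (hψ.antitone (by linarith))
    split_ifs with h
    · rw [mul_comm]
      exact mul_le_mul_of_nonneg_right (hbκ (by omega)) hnonneg
    · rw [zero_mul]
      positivity
  have htail : exp (-(β / 2) * max ((j : ℝ) - ⌊N⌋₊ - 1) 0) * |b| ≤
      6 * D * ((⌊N⌋₊ + 2) * (1 + 2 / β)) ^ 3 * (1 / (j + 1) ^ 2) := by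
    have h := exp_neg_mul_max_mul_cube_le (half_pos hβ) (p := ⌊N⌋₊ + 1) (x := j) (by positivity)
      (by positivity)
    rw [one_div_div, show (⌊N⌋₊ + 1 + 1 : ℝ) = ⌊N⌋₊ + 2 by ring, ← sub_sub] at h
    rw [mul_one_div, le_div_iff₀ (by positivity)]
    calc _ ≤ exp (-(β / 2) * max ((j : ℝ) - ⌊N⌋₊ - 1) 0) * (D * (j + 1)) * (j + 1) ^ 2 := by gcongr
      _ = D * (exp (-(β / 2) * max ((j : ℝ) - ⌊N⌋₊ - 1) 0) * (j + 1) ^ 3) := by ring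
      _ ≤ D * (6 * ((⌊N⌋₊ + 2) * (1 + 2 / β)) ^ 3) := by gcongr
      _ = _ := by ring
  rw [← sub_mul, abs_mul]
  refine (mul_le_mul_of_nonneg_right hweight (abs_nonneg b)).trans ?_
  rw [add_mul]
  refine add_le_add hincr ?_
  calc _ = 2 * C * exp (-(β / 2) * B) * (exp (-(β / 2) * max ((j : ℝ) - ⌊N⌋₊ - 1) 0) * |b|) := by
        ring
    _ ≤ 2 * C * exp (-(β / 2) * B) *
        (6 * D * ((⌊N⌋₊ + 2) * (1 + 2 / β)) ^ 3 * (1 / (j + 1) ^ 2)) := by gcongr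
    _ = _ := by ring

theorem abs_tsum_sub_sum_sum_range_le (hψ : IsExpTailed ψ β C) {N κ : ℝ} (hN : 0 ≤ N) {B : ℤ}
    (hB : 0 ≤ B) (hD : 0 ≤ D) (hκ : 0 ≤ κ) {a : ℕ → ℝ} (ha : ∀ j, |a j| ≤ D * (j + 1))
    (haκ : ∀ j : ℕ, (⌊N⌋₊ : ℤ) < j + B → |a j| ≤ κ) :
    |∑' j : ℕ, ψ (j - N) * a j - ∑ k ∈ Finset.Icc (-B) B,
        (ψ k - ψ (k + 1)) * ∑ j ∈ Finset.range (⌊N⌋₊ + 1 + k).toNat, a j| ≤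
      κ + 24 * C * D * exp (-(β / 2) * B) * ((⌊N⌋₊ + 2) * (1 + 2 / β)) ^ 3 := by
  have hC := hψ.const_pos
  have hβ := hψ.rate_pos
  have hcut := hasSum_cutoffWeight_mul ψ B ⌊N⌋₊ a
  have hdiff := (hψ.summable_mul N ha).hasSum.sub hcut
  obtain ⟨hsum, hle⟩ : Summable (fun j : ℕ => ψ (j - ⌊N⌋₊ - 1) - ψ (j - ⌊N⌋₊)) ∧
      ∑' j : ℕ, (ψ (j - ⌊N⌋₊ - 1) - ψ (j - ⌊N⌋₊)) ≤ 1 := by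
    have h := summable_and_tsum_sub_add_one_le (ψ := fun j : ℕ => ψ (j - ⌊N⌋₊ - 1))
      (fun i j hij => hψ.antitone (by gcongr)) fun _ => hψ.nonneg _
    have hcast (j : ℕ) : (((j + 1 : ℕ) : ℝ) - ⌊N⌋₊ - 1) = j - ⌊N⌋₊ := by push_cast; ring
    simp only [hcast] at h
    exact ⟨h.1, h.2.trans (hψ.le_one _)⟩
  set T := 12 * C * D * exp (-(β / 2) * B) * ((⌊N⌋₊ + 2) * (1 + 2 / β)) ^ 3 with hT
  have hbound := hdiff.norm_le_of_bounded
    ((hsum.hasSum.mul_left κ).add (summable_one_div_add_one_sq.hasSum.mul_left T))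
    fun j => hψ.abs_sub_cutoffWeight_mul_le hN hB hD (ha j) (haκ j) hκ
  have : 0 ≤ T := by positivity
  calc _ ≤ _ := hbound
    _ ≤ κ * 1 + T * 2 := by gcongr; exact tsum_one_div_add_one_sq_le
    _ = _ := by rw [hT]; ring

end IsExpTailed

/-! ### Kernels at the critical scale -/

theorem abs_hermiteFun_mul_le_four_div {j : ℕ} {u v r : ℝ} (hr : 0 < r) (hj : r ^ 2 ≤ 2 * j)
    (hu : |u| ≤ r / 2) (hv : |v| ≤ r / 2) : |hermiteFun j u * hermiteFun j v| ≤ 4 / r := by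
  obtain ⟨i, rfl⟩ : ∃ i, j = i + 1 := Nat.exists_eq_succ_of_ne_zero fun h => by
    rw [h, Nat.cast_zero, mul_zero] at hj
    nlinarith
  have hle : r ≤ ladderCoeff i := le_sqrt_of_sq_le (by exact_mod_cast hj)
  have hsq {w : ℝ} (hw : |w| ≤ r / 2) : hermiteFun (i + 1) w ^ 2 ≤ 4 / r :=
    (hermiteFun_succ_sq_le (by linarith)).trans (by gcongr)
  linarith [abs_mul_le_half_add_sq (hermiteFun (i + 1) u) (hermiteFun (i + 1) v), hsq hu, hsq hv]

theorem abs_hermiteKernel_floor_add_sub_sinc_le {N u v X : ℝ} (hN : 0 < N) {k : ℤ}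
    (hk : -(N / 2) ≤ k - 1) (hX : X ≤ √N / 2) (hu : |u| ≤ X) (hv : |v| ≤ X) :
    |hermiteKernel (⌊N⌋₊ + 1 + k).toNat u v -
        √(2 * (N + k)) / π * sinc (√(2 * (N + k)) * (u - v))| ≤ (6 * X ^ 2 + 14) / √N := by
  have hfloor_le := Nat.floor_le hN.le
  have hlt_floor := Nat.lt_floor_add_one N
  obtain ⟨n, hn⟩ : ∃ n : ℕ, ⌊N⌋₊ + k = n := Int.eq_ofNat_of_zero_le <| by
    have h : (0 : ℝ) < ⌊N⌋₊ + k + 1 := by linarith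
    exact Int.lt_add_one_iff.1 (by exact_mod_cast h)
  have hn' : (⌊N⌋₊ : ℝ) + k = n := by exact_mod_cast hn
  have hsqrt : √N ≤ √(2 * (N + k)) := sqrt_le_sqrt (by linarith)
  have hpos : 0 < √(2 * (N + k)) := (sqrt_pos.2 hN).trans_le hsqrt
  have hω : √(2 * (N + k)) ^ 2 = 2 * (N + k) := sq_sqrt (by linarith)
  rw [show ((⌊N⌋₊ : ℤ) + 1 + k).toNat = n + 1 by omega]
  have hladder : √N ≤ ladderCoeff n := sqrt_le_sqrt (by linarith)
  exact (abs_hermiteKernel_sub_sinc_le hu hv (by linarith) hpos (by linarith) (by linarith)).trans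
    (by gcongr)

theorem IsExpTailed.abs_tsum_hermiteFun_sub_sum_sinc_le {ψ : ℝ → ℝ} {β C : ℝ}
    (hψ : IsExpTailed ψ β C) {N u v X : ℝ} {B : ℤ} (hB : 0 ≤ B) (hBN : B + 1 ≤ N / 2)
    (hX : X ≤ √N / 2) (hu : |u| ≤ X) (hv : |v| ≤ X) :
    |∑' j : ℕ, ψ (j - N) * (hermiteFun j u * hermiteFun j v) - ∑ k ∈ Finset.Icc (-B) B,
        (ψ k - ψ (k + 1)) * (√(2 * (N + k)) / π * sinc (√(2 * (N + k)) * (u - v)))| ≤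
      (6 * X ^ 2 + 18) / √N +
        48 * C * exp (-(β / 2) * B) * ((⌊N⌋₊ + 2) * (1 + 2 / β)) ^ 3 := by
  have hB' : (0 : ℝ) ≤ B := by exact_mod_cast hB
  have hN : 0 < N := by linarith
  have hparts := hψ.abs_tsum_sub_sum_sum_range_le hN.le hB zero_le_two
    (show 0 ≤ 4 / √N by positivity) (fun j => abs_hermiteFun_mul_le j u v) fun j hj => by
      have hj' : (⌊N⌋₊ : ℝ) < j + B := by exact_mod_cast hj
      refine abs_hermiteFun_mul_le_four_div (sqrt_pos.2 hN) ?_ (hu.trans hX) (hv.trans hX)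
      rw [sq_sqrt hN.le]
      linarith [Nat.lt_floor_add_one N]
  have hprojections := abs_sum_sub_add_one_mul_le (a := -B) (b := B) (ψ := fun k : ℤ => ψ k)
    (D := (6 * X ^ 2 + 14) / √N)
    (g := fun k : ℤ => hermiteKernel (⌊N⌋₊ + 1 + k).toNat u v -
      √(2 * (N + k)) / π * sinc (√(2 * (N + k)) * (u - v)))
    (fun i j hij => hψ.antitone (by exact_mod_cast hij)) (fun _ => hψ.nonneg _)
    (fun _ => hψ.le_one _) (by positivity) fun k hk => by
      have hk' : (-B : ℝ) ≤ k := by exact_mod_cast (Finset.mem_Icc.1 hk).1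
      exact abs_hermiteKernel_floor_add_sub_sinc_le hN (by linarith) hX hu hv
  push_cast at hprojections
  simp only [mul_sub (_ - _), Finset.sum_sub_distrib] at hprojections
  refine (abs_sub_le _ _ _).trans ((add_le_add hparts hprojections).trans_eq ?_)
  ring

/-- The dilation factor between the scale of the kernels and that of the Hermite functions:
`φ_k(x N^{-α})` is a multiple of `h_k(hermiteScale α N * x)`. -/
def hermiteScale (α N : ℝ) : ℝ := π * √N / √2 * N ^ (-α)

theorem hermiteScale_nonneg {N : ℝ} (hN : 0 ≤ N) (α : ℝ) : 0 ≤ hermiteScale α N := by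
  unfold hermiteScale
  positivity

theorem modifiedGUETerm_eq (Ψ : ℝ → ℝ) (τ α N x y : ℝ) (k : ℕ) :
    modifiedGUETerm Ψ τ α N x y k = π * √N / √2 * (Ψ ((k - N) / (τ * N ^ α)) *
      (hermiteFun k (x * (π * √N / √2)) * hermiteFun k (y * (π * √N / √2)))) := by
  rw [modifiedGUETerm, rescaledHermite, rescaledHermite]
  nth_rw 5 [← mul_self_sqrt (show 0 ≤ π * √N / √2 by positivity)]
  ring

theorem criticalModifiedGUEKernel_eq (Ψ : ℝ → ℝ) (τ α N x y : ℝ) :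
    criticalModifiedGUEKernel Ψ τ α N x y = hermiteScale α N *
      ∑' k : ℕ, Ψ ((k - N) / (τ * N ^ α)) *
        (hermiteFun k (hermiteScale α N * x) * hermiteFun k (hermiteScale α N * y)) := by
  simp only [criticalModifiedGUEKernel, modifiedGUEKernel, modifiedGUETerm_eq, tsum_mul_left]
  rw [← mul_assoc, hermiteScale, mul_comm (N ^ (-α))]
  congr! 5 <;> ring_nf

/-- The mixture of sine kernels with `Γ = (log N)²` and `η(k) = N^{1-α} √(1 + k/N) / 2`, its weights
written as the increments `Ψ(k/(τN^α)) - Ψ((k+1)/(τN^α))` instead of as values of the density. -/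
def incrementSineKernel (Ψ : ℝ → ℝ) (τ α N x y : ℝ) : ℝ :=
  ∑ k ∈ Finset.Icc (-⌊log N ^ 2 * N ^ α⌋) ⌊log N ^ 2 * N ^ α⌋,
    (Ψ (k / (τ * N ^ α)) - Ψ ((k + 1) / (τ * N ^ α))) *
      sineFun (N ^ (1 - α) * √(1 + (k : ℝ) / N) / 2) (x - y)

theorem sineFun_eq_sinc (η u : ℝ) : sineFun η u = 2 * η * sinc (2 * π * η * u) := by
  rcases eq_or_ne u 0 with rfl | hu
  · simp [sineFun]
  rcases eq_or_ne η 0 with rfl | hη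
  · simp [sineFun]
  rw [sineFun, if_neg hu, sinc_of_ne_zero (by positivity)]
  field_simp

theorem sineFun_sub_eq_mul_sinc {η s ω : ℝ} (h : s * ω = 2 * π * η) (x y : ℝ) :
    sineFun η (x - y) = s * (ω / π * sinc (ω * (s * x - s * y))) := by
  rw [sineFun_eq_sinc, ← mul_assoc s, mul_div, h, ← mul_sub, ← mul_assoc ω, mul_comm ω, h]
  field_simp

theorem hermiteScale_mul_sqrt (α t : ℝ) {N : ℝ} (hN : 0 < N) :
    hermiteScale α N * √(2 * (N + t)) = 2 * π * (N ^ (1 - α) * √(1 + t / N) / 2) := by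
  have hsqrt : √(2 * (N + t)) = √2 * (√N * √(1 + t / N)) := by
    rw [← sqrt_mul hN.le, ← sqrt_mul zero_le_two]
    congr 1
    field_simp
  have hrpow : N ^ (1 - α) = √N * √N * N ^ (-α) := by
    rw [mul_self_sqrt hN.le, sub_eq_add_neg, rpow_add hN, rpow_one]
  rw [hermiteScale, hsqrt, hrpow]
  field_simp

theorem incrementSineKernel_eq (Ψ : ℝ → ℝ) (τ α : ℝ) {N : ℝ} (hN : 0 < N) (x y : ℝ) :
    incrementSineKernel Ψ τ α N x y = hermiteScale α N *
      ∑ k ∈ Finset.Icc (-⌊log N ^ 2 * N ^ α⌋) ⌊log N ^ 2 * N ^ α⌋,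
        (Ψ (k / (τ * N ^ α)) - Ψ ((k + 1) / (τ * N ^ α))) * (√(2 * (N + k)) / π *
          sinc (√(2 * (N + k)) * (hermiteScale α N * x - hermiteScale α N * y))) := by
  rw [incrementSineKernel, Finset.mul_sum]
  refine Finset.sum_congr rfl fun k _ => ?_
  rw [sineFun_sub_eq_mul_sinc (hermiteScale_mul_sqrt α k hN), mul_left_comm]

theorem eventually_exp_neg_mul_log_sq_le_rpow {γ : ℝ} (hγ : 0 < γ) (p : ℝ) :
    ∀ᶠ N : ℝ in atTop, exp (-γ * log N ^ 2) ≤ N ^ p := by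
  filter_upwards [tendsto_log_atTop.eventually_ge_atTop (-p / γ), eventually_ge_atTop 1]
    with N hlog hN
  rw [rpow_def_of_pos (by linarith), exp_le_exp]
  rw [div_le_iff₀ hγ] at hlog
  nlinarith [log_nonneg hN]

theorem eventually_log_sq_mul_rpow_add_one_le {α : ℝ} (hα1 : α < 1) :
    ∀ᶠ N : ℝ in atTop, log N ^ 2 * N ^ α + 1 ≤ N / 2 := by
  have h := (isLittleO_log_rpow_rpow_atTop 2 (sub_pos.2 hα1)).tendsto_div_nhds_zero
  filter_upwards [h.eventually_lt_const (show (0 : ℝ) < 1 / 4 by norm_num),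
    eventually_ge_atTop 4] with N hlog hN
  have hN0 : 0 < N := by linarith
  rw [div_lt_iff₀ (rpow_pos_of_pos hN0 _), rpow_two] at hlog
  have hsplit : N ^ (1 - α) * N ^ α = N := by
    rw [← rpow_add hN0, sub_add_cancel, rpow_one]
  nlinarith [rpow_pos_of_pos hN0 α]

theorem hermiteScale_le {α N : ℝ} (hα0 : 0 ≤ α) (hN : 1 ≤ N) : hermiteScale α N ≤ π * N := by
  have hN0 : 0 ≤ N := by linarith
  have hle_one : N ^ (-α) ≤ 1 := rpow_le_one_of_one_le_of_nonpos hN (by linarith)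
  have hsqrt : √N ≤ N := sqrt_le_iff.2 ⟨hN0, by nlinarith⟩
  calc hermiteScale α N ≤ π * N / 1 * 1 := by
        unfold hermiteScale
        gcongr
        exact one_le_sqrt.2 one_le_two
    _ = π * N := by ring

theorem eventually_hermiteScale_mul_le {α : ℝ} (hα0 : 0 < α) (A : ℝ) :
    ∀ᶠ N : ℝ in atTop, hermiteScale α N * A ≤ √N / 2 := by
  have hdecay : Tendsto (fun N : ℝ => π / √2 * A * N ^ (-α)) atTop (𝓝 0) := by
    simpa using (tendsto_rpow_neg_atTop hα0).const_mul (π / √2 * A)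
  filter_upwards [hdecay.eventually_le_const (show (0 : ℝ) < 1 / 2 by norm_num)] with N hN
  calc hermiteScale α N * A = √N * (π / √2 * A * N ^ (-α)) := by unfold hermiteScale; ring
    _ ≤ √N * (1 / 2) := by gcongr
    _ = √N / 2 := by ring

theorem hermiteScale_mul_div_sqrt_le {α N : ℝ} (A : ℝ) (hN : 1 ≤ N) :
    hermiteScale α N * ((6 * (hermiteScale α N * A) ^ 2 + 18) / √N) ≤
      (6 * A ^ 2 * (π / √2) ^ 3 + 18 * (π / √2)) * N ^ (-min (3 * α - 1) α) := by
  have hN0 : 0 < N := by linarith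
  have hconst : N ^ (-α) ≤ N ^ (-min (3 * α - 1) α) :=
    rpow_le_rpow_of_exponent_le hN (neg_le_neg (min_le_right _ _))
  have hquad : √N ^ 2 * (N ^ (-α)) ^ 3 ≤ N ^ (-min (3 * α - 1) α) := by
    rw [sq_sqrt hN0.le, ← rpow_natCast (N ^ (-α)), ← rpow_mul hN0.le]
    nth_rw 1 [← rpow_one N]
    rw [← rpow_add hN0]
    refine rpow_le_rpow_of_exponent_le hN ?_
    push_cast
    linarith [min_le_left (3 * α - 1) α]
  calc _ = 6 * A ^ 2 * (π / √2) ^ 3 * (√N ^ 2 * (N ^ (-α)) ^ 3) + 18 * (π / √2) * N ^ (-α) := by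
        unfold hermiteScale
        field_simp
    _ ≤ _ := by
        rw [add_mul]
        gcongr

theorem hermiteScale_mul_tail_le {α τ β C N : ℝ} (hα0 : 0 ≤ α) (hα1 : α ≤ 1) (hτ : 0 < τ)
    (hβ : 0 < β) (hC : 0 ≤ C) (hN : 1 ≤ N) :
    hermiteScale α N * (48 * C * exp (-(β / (τ * N ^ α) / 2) * ⌊log N ^ 2 * N ^ α⌋) *
        ((⌊N⌋₊ + 2) * (1 + 2 / (β / (τ * N ^ α)))) ^ 3) ≤
      48 * π * C * exp (β / τ / 2) * (3 * (1 + 2 * τ / β)) ^ 3 *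
        (exp (-(β / τ / 2) * log N ^ 2) * N ^ 7) := by
  have hN0 : 0 < N := by linarith
  have hNα : 1 ≤ N ^ α := one_le_rpow hN hα0
  have hNα' : N ^ α ≤ N := rpow_le_self_of_one_le hN hα1
  have hexp : exp (-(β / (τ * N ^ α) / 2) * ⌊log N ^ 2 * N ^ α⌋) ≤
      exp (β / τ / 2) * exp (-(β / τ / 2) * log N ^ 2) := by
    rw [← exp_add, exp_le_exp]
    calc -(β / (τ * N ^ α) / 2) * ⌊log N ^ 2 * N ^ α⌋
        ≤ -(β / (τ * N ^ α) / 2) * (log N ^ 2 * N ^ α - 1) := by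
          refine mul_le_mul_of_nonpos_left (Int.sub_one_lt_floor _).le ?_
          rw [neg_nonpos]
          positivity
      _ = β / (τ * N ^ α) / 2 + -(β / τ / 2) * log N ^ 2 := by field_simp; ring
      _ ≤ β / τ / 2 + -(β / τ / 2) * log N ^ 2 := by
          gcongr
          exact le_mul_of_one_le_right hτ.le hNα
  have hpoly : (⌊N⌋₊ + 2) * (1 + 2 / (β / (τ * N ^ α))) ≤ 3 * (1 + 2 * τ / β) * N ^ 2 :=
    calc (⌊N⌋₊ + 2) * (1 + 2 / (β / (τ * N ^ α))) = (⌊N⌋₊ + 2) * (1 + 2 * τ / β * N ^ α) := by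
          field_simp
      _ ≤ (3 * N) * (N + 2 * τ / β * N) := by
          gcongr
          linarith [Nat.floor_le hN0.le]
      _ = _ := by ring
  calc _ ≤ π * N * (48 * C * (exp (β / τ / 2) * exp (-(β / τ / 2) * log N ^ 2)) *
        (3 * (1 + 2 * τ / β) * N ^ 2) ^ 3) := by
        gcongr
        exact hermiteScale_le hα0 hN
    _ = _ := by ring

theorem IsExpTailed.exists_abs_criticalKernel_sub_le {Ψ : ℝ → ℝ} {β C : ℝ}
    (hΨ : IsExpTailed Ψ β C) {α τ : ℝ} (hα0 : 0 < α) (hα1 : α < 1) (hτ : 0 < τ) (A : ℝ) :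
    ∃ E, ∀ᶠ N : ℝ in atTop, ∀ x y : ℝ, |x| ≤ A → |y| ≤ A →
      |criticalModifiedGUEKernel Ψ τ α N x y - incrementSineKernel Ψ τ α N x y| ≤
        E * N ^ (-min (3 * α - 1) α) := by
  have hC := hΨ.const_pos
  have hβ := hΨ.rate_pos
  set E₂ := 48 * π * C * exp (β / τ / 2) * (3 * (1 + 2 * τ / β)) ^ 3
  refine ⟨6 * A ^ 2 * (π / √2) ^ 3 + 18 * (π / √2) + E₂, ?_⟩
  filter_upwards [eventually_ge_atTop 1, eventually_log_sq_mul_rpow_add_one_le hα1,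
    eventually_hermiteScale_mul_le hα0 A, eventually_exp_neg_mul_log_sq_le_rpow
      (show 0 < β / τ / 2 by positivity) (-min (3 * α - 1) α - 7)] with N hN hB hA hexp x y hx hy
  have hN0 : 0 < N := by linarith
  have hs := hermiteScale_nonneg hN0.le α
  have harg {z : ℝ} (hz : |z| ≤ A) : |hermiteScale α N * z| ≤ hermiteScale α N * A := by
    rw [abs_mul, abs_of_nonneg hs]
    gcongr
  have hmain := (hΨ.comp_div (show 0 < τ * N ^ α by positivity)).abs_tsum_hermiteFun_sub_sum_sinc_le
    (B := ⌊log N ^ 2 * N ^ α⌋) (Int.floor_nonneg.2 (by positivity))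
    (by linarith [Int.floor_le (log N ^ 2 * N ^ α)]) hA (harg hx) (harg hy)
  have htail := hermiteScale_mul_tail_le hα0.le hα1.le hτ hβ hC.le hN
  rw [criticalModifiedGUEKernel_eq, incrementSineKernel_eq Ψ τ α hN0, ← mul_sub, abs_mul,
    abs_of_nonneg hs]
  refine (mul_le_mul_of_nonneg_left hmain hs).trans ?_
  rw [mul_add, add_mul _ E₂]
  refine add_le_add (hermiteScale_mul_div_sqrt_le A hN) (htail.trans ?_)
  gcongr
  calc exp (-(β / τ / 2) * log N ^ 2) * N ^ 7
      ≤ N ^ (-min (3 * α - 1) α - 7) * N ^ 7 := by gcongr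
    _ = N ^ (-min (3 * α - 1) α) := by
        rw [← rpow_natCast, ← rpow_add hN0]
        norm_num

theorem IsExpTailed.summable_modifiedGUETerm {Ψ : ℝ → ℝ} {β C : ℝ} (hΨ : IsExpTailed Ψ β C)
    {τ N : ℝ} (hτ : 0 < τ) (hN : 0 < N) (α x y : ℝ) : Summable (modifiedGUETerm Ψ τ α N x y) := by
  simp only [funext (modifiedGUETerm_eq Ψ τ α N x y)]
  exact ((hΨ.comp_div (show 0 < τ * N ^ α by positivity)).summable_mul N
    fun j => abs_hermiteFun_mul_le j _ _).mul_left _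

theorem IsExpTailed.continuous_criticalModifiedGUEKernel {Ψ : ℝ → ℝ} {β C : ℝ}
    (hΨ : IsExpTailed Ψ β C) {τ N : ℝ} (hτ : 0 < τ) (hN : 0 < N) (α : ℝ) :
    Continuous fun z : ℝ × ℝ => criticalModifiedGUEKernel Ψ τ α N z.1 z.2 := by
  have hψ := hΨ.comp_div (show 0 < τ * N ^ α by positivity)
  simp only [criticalModifiedGUEKernel_eq]
  refine continuous_const.mul (continuous_tsum (fun j => ?_)
    ((summable_add_one_mul_exp_neg hψ.rate_pos).mul_left _)
    fun j z => hψ.abs_mul_le N (abs_hermiteFun_mul_le j _ _))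
  have := continuous_hermiteFun j
  fun_prop

theorem continuous_incrementSineKernel (Ψ : ℝ → ℝ) (τ α N : ℝ) :
    Continuous fun z : ℝ × ℝ => incrementSineKernel Ψ τ α N z.1 z.2 := by
  simp only [incrementSineKernel, sineFun_eq_sinc]
  have := continuous_sinc
  fun_prop

theorem abs_sineFun_le_inv {η u : ℝ} (hu : u ≠ 0) : |sineFun η u| ≤ |u|⁻¹ := by
  rw [sineFun, if_neg hu, abs_div, abs_mul, abs_of_pos pi_pos, ← one_div]
  gcongr
  · exact abs_sin_le_one _
  · exact le_mul_of_one_le_left (abs_nonneg u) (by linarith [pi_gt_three])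

theorem abs_sineFun_le {η : ℝ} (hη : 0 ≤ η) (u : ℝ) : |sineFun η u| ≤ 2 * η := by
  rw [sineFun_eq_sinc, abs_mul, abs_of_nonneg (by positivity)]
  exact mul_le_of_le_one_right (by positivity) (abs_sinc_le_one _)

theorem IsExpTailed.abs_incrementSineKernel_le {Ψ : ℝ → ℝ} {β C : ℝ} (hΨ : IsExpTailed Ψ β C)
    {τ α N D x y : ℝ} (hτ : 0 < τ) (hN : 0 < N) (hD : 0 ≤ D)
    (hsine : ∀ k : ℤ, k ≤ log N ^ 2 * N ^ α →
      |sineFun (N ^ (1 - α) * √(1 + (k : ℝ) / N) / 2) (x - y)| ≤ D) :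
    |incrementSineKernel Ψ τ α N x y| ≤ D := by
  have hψ := hΨ.comp_div (show 0 < τ * N ^ α by positivity)
  have h := abs_sum_sub_add_one_mul_le (a := -⌊log N ^ 2 * N ^ α⌋) (b := ⌊log N ^ 2 * N ^ α⌋)
    (ψ := fun k : ℤ => Ψ (k / (τ * N ^ α)))
    (fun i j hij => hψ.antitone (by exact_mod_cast hij)) (fun _ => hΨ.nonneg _)
    (fun _ => hΨ.le_one _) hD fun k hk => hsine k (Int.le_floor.1 (Finset.mem_Icc.1 hk).2)
  push_cast at h
  exact h

theorem IsExpTailed.abs_incrementSineKernel_le_inv {Ψ : ℝ → ℝ} {β C : ℝ}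
    (hΨ : IsExpTailed Ψ β C) {τ N x y : ℝ} (hτ : 0 < τ) (hN : 0 < N) (α : ℝ) (hxy : x ≠ y) :
    |incrementSineKernel Ψ τ α N x y| ≤ |x - y|⁻¹ :=
  hΨ.abs_incrementSineKernel_le hτ hN (by positivity)
    fun _ _ => abs_sineFun_le_inv (sub_ne_zero.2 hxy)

theorem IsExpTailed.eventually_abs_incrementSineKernel_le {Ψ : ℝ → ℝ} {β C : ℝ}
    (hΨ : IsExpTailed Ψ β C) {τ α : ℝ} (hτ : 0 < τ) (hα0 : 0 ≤ α) (hα1 : α < 1) :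
    ∀ᶠ N : ℝ in atTop, ∀ x y, |incrementSineKernel Ψ τ α N x y| ≤ 2 * N := by
  filter_upwards [eventually_ge_atTop 1, eventually_log_sq_mul_rpow_add_one_le hα1]
    with N hN hB x y
  have hN0 : 0 < N := by linarith
  refine hΨ.abs_incrementSineKernel_le hτ hN0 (by positivity) fun k hk => ?_
  have hrpow : N ^ (1 - α) ≤ N := rpow_le_self_of_one_le hN (by linarith)
  have hsqrt : √(1 + (k : ℝ) / N) ≤ 2 := by
    have hk' : (k : ℝ) / N ≤ 1 := (div_le_one hN0).2 (by linarith)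
    exact sqrt_le_iff.2 ⟨by norm_num, by linarith⟩
  calc _ ≤ 2 * (N ^ (1 - α) * √(1 + (k : ℝ) / N) / 2) := abs_sineFun_le (by positivity) _
    _ = N ^ (1 - α) * √(1 + (k : ℝ) / N) := by ring
    _ ≤ N * 2 := by gcongr
    _ = 2 * N := mul_comm _ _

/-! ### Cyclic products and traces -/

theorem prod_univ_erase_finRotate {M : Type*} [CommMonoid M] {n : ℕ} (i : Fin (n + 1))
    (h : Fin (n + 1) → Fin (n + 1) → M) :
    ∏ j ∈ Finset.univ.erase i, h j (finRotate (n + 1) j) =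
      ∏ j : Fin n, h (j.castSucc + (i + 1)) (j.succ + (i + 1)) := by
  have hlast : Fin.last n + (i + 1) = i := by
    rw [add_comm i 1, ← add_assoc, Fin.last_add_one, zero_add]
  refine (Finset.prod_bij (fun (j : Fin n) _ => j.castSucc + (i + 1)) ?_ ?_ ?_
    fun j _ => ?_).symm
  · intro j _
    refine Finset.mem_erase_of_ne_of_mem (fun hj => ?_) (Finset.mem_univ _)
    exact (Fin.castSucc_lt_last j).ne (add_right_cancel (hj.trans hlast.symm))
  · simp
  · intro j hj
    have hne : j - (i + 1) ≠ Fin.last n := fun h =>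
      Finset.ne_of_mem_erase hj (by rw [← hlast, ← h, sub_add_cancel])
    obtain ⟨k, hk⟩ := Fin.exists_castSucc_eq.2 hne
    exact ⟨k, Finset.mem_univ k, by rw [hk, sub_add_cancel]⟩
  · rw [finRotate_apply, ← Fin.coeSucc_eq_succ]
    congr 1
    abel

section Chain

variable {X : Type*} [MeasureSpace X]

theorem measurable_comp_coordinates {g : X → X → ENNReal} (hg : Measurable (Function.uncurry g))
    {ι : Type*} (i j : ι) : Measurable fun x : ι → X => g (x i) (x j) :=
  hg.comp (.prodMk (measurable_pi_apply i) (measurable_pi_apply j) :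
    Measurable fun x : ι → X => (x i, x j))

variable [SigmaFinite (volume : Measure X)]

theorem lintegral_fin_succ_pi {n : ℕ} {F : (Fin (n + 1) → X) → ENNReal} (hF : Measurable F) :
    ∫⁻ x, F x = ∫⁻ y : Fin n → X, ∫⁻ t, F (Fin.cons t y) := by
  have hmp := (volume_preserving_piFinSuccAbove (fun _ : Fin (n + 1) => X) 0).symm
  rw [← hmp.lintegral_comp hF, Measure.volume_eq_prod,
    lintegral_prod_symm' (fun z => F ((MeasurableEquiv.piFinSuccAbove _ 0).symm z))
      (hF.comp hmp.measurable)]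
  simp [MeasurableEquiv.piFinSuccAbove_symm_apply, Fin.consEquiv]

theorem lintegral_chain_le {g : X → X → ENNReal} (hg : Measurable (Function.uncurry g))
    {c : ENNReal} (hc : ∀ x, ∫⁻ y, g x y ≤ c) (n : ℕ) {w : X → ENNReal} (hw : Measurable w) :
    ∫⁻ x : Fin (n + 1) → X, w (x 0) * ∏ j : Fin n, g (x j.castSucc) (x j.succ) ≤
      c ^ n * ∫⁻ t, w t := by
  have hmeas (n : ℕ) {w : X → ENNReal} (hw : Measurable w) : Measurable fun x : Fin (n + 1) → X =>
      w (x 0) * ∏ j : Fin n, g (x j.castSucc) (x j.succ) :=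
    (hw.comp (measurable_pi_apply 0)).mul
      (Finset.measurable_prod _ fun j _ => measurable_comp_coordinates hg _ _)
  induction n generalizing w with
  | zero =>
    simp only [Finset.univ_eq_empty, Finset.prod_empty, mul_one, pow_zero, one_mul]
    exact ((volume_preserving_funUnique (Fin 1) X).lintegral_comp hw).le
  | succ n ih =>
    have hwg : Measurable (Function.uncurry fun t s => w t * g t s) :=
      (hw.comp measurable_fst).mul hg
    calc ∫⁻ x : Fin (n + 2) → X, w (x 0) * ∏ j : Fin (n + 1), g (x j.castSucc) (x j.succ)
        = ∫⁻ y : Fin (n + 1) → X, (∫⁻ t, w t * g t (y 0)) *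
            ∏ j : Fin n, g (y j.castSucc) (y j.succ) := by
          rw [lintegral_fin_succ_pi (hmeas _ hw)]
          refine lintegral_congr fun y => ?_
          have hwgy : Measurable fun t => w t * g t (y 0) := hwg.comp measurable_prodMk_right
          rw [← lintegral_mul_const _ hwgy]
          simp only [Fin.prod_univ_succ, Fin.cons_zero, Fin.castSucc_zero, Fin.cons_succ,
            ← Fin.succ_castSucc, mul_assoc]
      _ ≤ c ^ n * ∫⁻ s, ∫⁻ t, w t * g t s := ih hwg.lintegral_prod_left'
      _ = c ^ n * ∫⁻ t, w t * ∫⁻ s, g t s := by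
          rw [← lintegral_lintegral_swap hwg.aemeasurable]
          congr! 3 with t
          exact lintegral_const_mul _ (hg.comp measurable_prodMk_left)
      _ ≤ c ^ n * ∫⁻ t, w t * c := by gcongr with t; exact hc t
      _ = c ^ (n + 1) * ∫⁻ t, w t := by rw [lintegral_mul_const _ hw]; ring

theorem lintegral_cycle_erase_le {g : X → X → ENNReal} (hg : Measurable (Function.uncurry g))
    {c : ENNReal} (hc : ∀ x, ∫⁻ y, g x y ≤ c) {ℓ : ℕ} (i : Fin ℓ) {w : X → ENNReal}
    (hw : Measurable w) :
    ∫⁻ x : Fin ℓ → X, w (x (finRotate ℓ i)) *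
      ∏ j ∈ Finset.univ.erase i, g (x j) (x (finRotate ℓ j)) ≤ c ^ (ℓ - 1) * ∫⁻ t, w t := by
  obtain _ | n := ℓ
  · exact i.elim0
  · refine le_trans (le_of_eq ?_) (lintegral_chain_le hg hc n hw)
    have hmp := (volume_measurePreserving_piCongrLeft (fun _ : Fin (n + 1) => X)
      (Equiv.addRight (i + 1))).symm
    rw [← hmp.lintegral_comp_emb (MeasurableEquiv.measurableEmbedding _)
      fun x => w (x 0) * ∏ j : Fin n, g (x j.castSucc) (x j.succ)]
    refine lintegral_congr fun x => ?_
    have hx (j : Fin (n + 1)) : (MeasurableEquiv.piCongrLeft (fun _ : Fin (n + 1) => X)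
      (Equiv.addRight (i + 1))).symm x j = x (j + (i + 1)) := rfl
    rw [prod_univ_erase_finRotate i fun j k => g (x j) (x k)]
    simp only [hx, zero_add, finRotate_apply]

end Chain

theorem enorm_prod_eq {ι R : Type*} [NormedCommRing R] [NormMulClass R] [NormOneClass R]
    (s : Finset ι) (a : ι → R) : ‖∏ i ∈ s, a i‖ₑ = ∏ i ∈ s, ‖a i‖ₑ := by
  simp [enorm_eq_nnnorm, nnnorm_prod]

theorem enorm_prod_sub_prod_le {ι R : Type*} [DecidableEq ι] [NormedCommRing R]
    [NormMulClass R] [NormOneClass R] (s : Finset ι) (a b : ι → R)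
    {G d : ι → ENNReal} (ha : ∀ i ∈ s, ‖a i‖ₑ ≤ G i) (hb : ∀ i ∈ s, ‖b i‖ₑ ≤ G i)
    (hd : ∀ i ∈ s, ‖a i - b i‖ₑ ≤ d i) :
    ‖∏ i ∈ s, a i - ∏ i ∈ s, b i‖ₑ ≤ ∑ i ∈ s, d i * ∏ j ∈ s.erase i, G j := by
  induction s using Finset.induction_on with
  | empty => simp
  | insert k s hk ih =>
    rw [Finset.forall_mem_insert] at ha hb hd
    have hstep : a k * ∏ i ∈ s, a i - b k * ∏ i ∈ s, b i =
        (a k - b k) * ∏ i ∈ s, a i + b k * (∏ i ∈ s, a i - ∏ i ∈ s, b i) := by ring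
    rw [Finset.prod_insert hk, Finset.prod_insert hk, Finset.sum_insert hk,
      Finset.erase_insert hk, hstep]
    refine (enorm_add_le _ _).trans (add_le_add ?_ ?_) <;> rw [enorm_mul]
    · gcongr
      · exact hd.1
      · rw [enorm_prod_eq]
        exact Finset.prod_le_prod' ha.2
    · refine (mul_le_mul' hb.1 (ih ha.2 hb.2 hd.2)).trans_eq ?_
      rw [Finset.mul_sum]
      refine Finset.sum_congr rfl fun i hi => ?_
      rw [Finset.erase_insert_of_ne (ne_of_mem_of_not_mem hi hk).symm,
        Finset.prod_insert (fun h => hk (Finset.mem_of_mem_erase h)), mul_left_comm]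

section Trace

variable {K L : ℝ → ℝ → ℝ} {f : ℝ → ℝ} {n : ℕ}

theorem traceIntegrand_eq_zero (K : ℝ → ℝ → ℝ) (m : Composition n) {x : Fin m.length → ℝ}
    {i : Fin m.length} (hi : f (x i) = 0) : traceIntegrand K f m x = 0 :=
  Finset.prod_eq_zero (Finset.mem_univ i) <| by
    rw [hi, zero_pow (Nat.one_le_iff_ne_zero.1 (m.one_le_blocksFun i)), zero_mul]

theorem continuous_traceIntegrand (hK : Continuous (Function.uncurry K)) (hf : Continuous f)
    (m : Composition n) : Continuous (traceIntegrand K f m) :=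
  continuous_finsetProd _ fun i _ => ((hf.comp (continuous_apply i)).pow _).mul <|
    hK.comp₂ (continuous_apply i) (continuous_apply _)

theorem hasCumulants_of_continuous (hK : Continuous (Function.uncurry K)) : HasCumulants K := by
  intro f hf hfc n _ m
  refine (continuous_traceIntegrand hK hf m).integrable_of_hasCompactSupport <|
    HasCompactSupport.intro (isCompact_univ_pi fun _ => hfc) fun x hx => ?_
  simp only [Set.mem_pi, Set.mem_univ, true_imp_iff, not_forall] at hx
  obtain ⟨i, hi⟩ := hx
  exact traceIntegrand_eq_zero K m (image_eq_zero_of_notMem_tsupport hi)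

variable {S : Set ℝ} {F ε : ENNReal} {g : ℝ → ℝ → ENNReal}

theorem enorm_traceIntegrand_sub_le (hS : ∀ x, x ∉ S → f x = 0) (hF : ∀ x, ‖f x‖ₑ ≤ F)
    (hK : ∀ x ∈ S, ∀ y ∈ S, ‖K x y‖ₑ ≤ g x y) (hL : ∀ x ∈ S, ∀ y ∈ S, ‖L x y‖ₑ ≤ g x y)
    (hε : ∀ x ∈ S, ∀ y ∈ S, ‖K x y - L x y‖ₑ ≤ ε) (m : Composition n) (x : Fin m.length → ℝ) :
    ‖traceIntegrand K f m x - traceIntegrand L f m x‖ₑ ≤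
      F ^ n * ∑ i, ε * (S.indicator 1 (x (finRotate m.length i)) *
        ∏ j ∈ Finset.univ.erase i, g (x j) (x (finRotate m.length j))) := by
  by_cases hx : ∀ i, x i ∈ S
  · unfold traceIntegrand
    rw [Finset.prod_mul_distrib, Finset.prod_mul_distrib, ← mul_sub, enorm_mul]
    gcongr ?_ * ?_
    · calc ‖∏ i, f (x i) ^ m.blocksFun i‖ₑ ≤ ∏ i, F ^ m.blocksFun i := by
            simp only [enorm_prod_eq, enorm_pow]
            gcongr
            exact hF _
        _ = F ^ n := by rw [Finset.prod_pow_eq_pow_sum, m.sum_blocksFun]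
    · simpa only [Set.indicator_of_mem (hx _), Pi.one_apply, one_mul] using
        enorm_prod_sub_prod_le Finset.univ _ _ (fun i _ => hK _ (hx i) _ (hx _))
          (fun i _ => hL _ (hx i) _ (hx _)) (fun i _ => hε _ (hx i) _ (hx _))
  · push Not at hx
    obtain ⟨i, hi⟩ := hx
    simp [traceIntegrand_eq_zero _ m (hS _ hi)]

theorem enorm_integral_traceIntegrand_sub_le {m : Composition n}
    (hKi : Integrable (traceIntegrand K f m)) (hLi : Integrable (traceIntegrand L f m))
    (hSm : MeasurableSet S) (hS : ∀ x, x ∉ S → f x = 0) (hF : ∀ x, ‖f x‖ₑ ≤ F)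
    (hK : ∀ x ∈ S, ∀ y ∈ S, ‖K x y‖ₑ ≤ g x y) (hL : ∀ x ∈ S, ∀ y ∈ S, ‖L x y‖ₑ ≤ g x y)
    (hε : ∀ x ∈ S, ∀ y ∈ S, ‖K x y - L x y‖ₑ ≤ ε) (hg : Measurable (Function.uncurry g))
    {c : ENNReal} (hc : ∀ x, ∫⁻ y, g x y ≤ c) :
    ‖(∫ x, traceIntegrand K f m x) - ∫ x, traceIntegrand L f m x‖ₑ ≤
      F ^ n * (m.length * (ε * (c ^ (m.length - 1) * volume S))) := by
  have hind : Measurable (S.indicator (1 : ℝ → ENNReal)) := measurable_one.indicator hSm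
  have hterm (i : Fin m.length) : Measurable fun x : Fin m.length → ℝ =>
      S.indicator (1 : ℝ → ENNReal) (x (finRotate m.length i)) *
        ∏ j ∈ Finset.univ.erase i, g (x j) (x (finRotate m.length j)) :=
    (hind.comp (measurable_pi_apply _)).mul
      (Finset.measurable_prod _ fun j _ => measurable_comp_coordinates hg _ _)
  rw [← integral_sub hKi hLi]
  calc _ ≤ ∫⁻ x : Fin m.length → ℝ, F ^ n * ∑ i, ε *
          (S.indicator 1 (x (finRotate m.length i)) *
            ∏ j ∈ Finset.univ.erase i, g (x j) (x (finRotate m.length j))) :=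
        (enorm_integral_le_lintegral_enorm _).trans
          (lintegral_mono (enorm_traceIntegrand_sub_le hS hF hK hL hε m))
    _ = F ^ n * ∑ i, ε * ∫⁻ x : Fin m.length → ℝ,
          S.indicator 1 (x (finRotate m.length i)) *
            ∏ j ∈ Finset.univ.erase i, g (x j) (x (finRotate m.length j)) := by
        rw [lintegral_const_mul _ (Finset.measurable_sum _ fun i _ => (hterm i).const_mul ε),
          lintegral_finsetSum _ fun i _ => (hterm i).const_mul ε]
        simp only [lintegral_const_mul _ (hterm _)]
    _ ≤ F ^ n * ∑ _i : Fin m.length, ε * (c ^ (m.length - 1) * volume S) := by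
        gcongr with i
        rw [← lintegral_indicator_one hSm]
        exact lintegral_cycle_erase_le hg hc i hind
    _ = F ^ n * (m.length * (ε * (c ^ (m.length - 1) * volume S))) := by simp

end Trace

/-! ### Asymptotic equivalence -/

theorem le_rpow_mul_rpow_sub_one {q M r : ENNReal} {κ : ℝ} (hκ0 : 0 ≤ κ) (hκ1 : κ ≤ 1)
    (hM : q ≤ M) (hr : q ≤ r⁻¹) : q ≤ M ^ κ * r ^ (κ - 1) :=
  have hκ1' : 0 ≤ 1 - κ := sub_nonneg.2 hκ1
  calc q = q ^ κ * q ^ (1 - κ) := by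
        rw [← ENNReal.rpow_add_of_nonneg _ _ hκ0 hκ1', add_sub_cancel, ENNReal.rpow_one]
    _ ≤ M ^ κ * r⁻¹ ^ (1 - κ) := by gcongr
    _ = M ^ κ * r ^ (κ - 1) := by rw [ENNReal.inv_rpow, ← ENNReal.rpow_neg, neg_sub]

theorem enorm_le_ofReal {a b : ℝ} (h : |a| ≤ b) : ‖a‖ₑ ≤ ENNReal.ofReal b := by
  rw [Real.enorm_eq_ofReal_abs]
  exact ENNReal.ofReal_le_ofReal h

theorem enorm_le_inv_enorm_sub {x y q : ℝ} (h : x ≠ y → |q| ≤ |x - y|⁻¹) :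
    ‖q‖ₑ ≤ ‖x - y‖ₑ⁻¹ := by
  rcases eq_or_ne x y with rfl | hxy
  · simp
  · rw [Real.enorm_eq_ofReal_abs (x - y),
      ← ENNReal.ofReal_inv_of_pos (abs_pos.2 (sub_ne_zero.2 hxy))]
    exact enorm_le_ofReal (h hxy)

theorem setLIntegral_enorm_rpow_lt_top {S : Set ℝ} (hS : IsCompact S) {r : ℝ} (hr : -1 < r) :
    ∫⁻ u in S, ‖u‖ₑ ^ r < ⊤ := by
  have hloc : LocallyIntegrable fun u : ℝ => |u| ^ r :=
    locallyIntegrable_of_norm_le_rpow (C := 1) (α := -r) (by simp) (by simpa using neg_lt.1 hr)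
      (Eventually.of_forall fun u => by
        rw [neg_neg, one_mul, Real.norm_eq_abs, Real.norm_eq_abs, abs_of_nonneg (by positivity)])
      (measurable_norm.pow_const r).aestronglyMeasurable
  have hne : ∀ᵐ u ∂volume.restrict S, u ≠ 0 := ae_restrict_of_ae (by simp [ae_iff])
  refine lt_of_eq_of_lt (lintegral_congr_ae ?_) (hloc.integrableOn_isCompact hS).2
  filter_upwards [hne] with u hu
  rw [Real.enorm_eq_ofReal_abs, Real.enorm_eq_ofReal (by positivity),
    ENNReal.ofReal_rpow_of_pos (abs_pos.2 hu)]

/-- The kernel `M ^ κ * |x - y| ^ (κ - 1) + 1`, cut off at distance `2 * A`. It dominates on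
`[-A, A]²` every kernel bounded by `M` and by `|x - y|⁻¹`, up to an error `1`, and its row
integrals are `O(M ^ κ)`. It may be infinite on the diagonal. -/
def rieszMajorant (A κ : ℝ) (M : ENNReal) (x y : ℝ) : ENNReal :=
  (Set.Icc (-(2 * A)) (2 * A)).indicator (fun u => M ^ κ * ‖u‖ₑ ^ (κ - 1) + 1) (x - y)

theorem measurable_rieszMajorant (A κ : ℝ) (M : ENNReal) :
    Measurable (Function.uncurry (rieszMajorant A κ M)) := by
  refine Measurable.comp (Measurable.indicator ?_ measurableSet_Icc)
    (measurable_fst.sub measurable_snd)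
  fun_prop

theorem exists_lintegral_rieszMajorant_le (A : ℝ) {κ : ℝ} (hκ : 0 < κ) :
    ∃ J : ENNReal, J ≠ ⊤ ∧ ∀ M, 1 ≤ M → ∀ x, ∫⁻ y, rieszMajorant A κ M x y ≤ J * M ^ κ := by
  refine ⟨∫⁻ u in Set.Icc (-(2 * A)) (2 * A), (‖u‖ₑ ^ (κ - 1) + 1), ?_, fun M hM x => ?_⟩
  · rw [lintegral_add_right _ measurable_const]
    exact ENNReal.add_ne_top.2
      ⟨(setLIntegral_enorm_rpow_lt_top isCompact_Icc (by linarith)).ne, by simp⟩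
  · have hMκ : 1 ≤ M ^ κ := ENNReal.one_le_rpow hM hκ
    calc ∫⁻ y, rieszMajorant A κ M x y
        = ∫⁻ u in Set.Icc (-(2 * A)) (2 * A), (M ^ κ * ‖u‖ₑ ^ (κ - 1) + 1) := by
          rw [← lintegral_indicator measurableSet_Icc]
          exact lintegral_sub_left_eq_self (μ := volume) (Set.indicator _ _) x
      _ ≤ ∫⁻ u in Set.Icc (-(2 * A)) (2 * A), (‖u‖ₑ ^ (κ - 1) + 1) * M ^ κ := by
          refine lintegral_mono fun u => ?_
          rw [add_mul, one_mul, mul_comm]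
          gcongr
      _ = _ := lintegral_mul_const _ (by fun_prop)

theorem enorm_le_rieszMajorant {A κ : ℝ} (hκ0 : 0 ≤ κ) (hκ1 : κ ≤ 1) {M : ENNReal} {x y : ℝ}
    (hx : x ∈ Set.Icc (-A) A) (hy : y ∈ Set.Icc (-A) A) {a b : ℝ} (hab : ‖a - b‖ₑ ≤ 1)
    (hM : ‖b‖ₑ ≤ M) (hb : ‖b‖ₑ ≤ ‖x - y‖ₑ⁻¹) : ‖a‖ₑ ≤ rieszMajorant A κ M x y := by
  have hmem : x - y ∈ Set.Icc (-(2 * A)) (2 * A) := by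
    constructor <;> linarith [hx.1, hx.2, hy.1, hy.2]
  rw [rieszMajorant, Set.indicator_of_mem hmem]
  calc ‖a‖ₑ = ‖b + (a - b)‖ₑ := by rw [add_sub_cancel]
    _ ≤ ‖b‖ₑ + ‖a - b‖ₑ := enorm_add_le _ _
    _ ≤ M ^ κ * ‖x - y‖ₑ ^ (κ - 1) + 1 := by
        gcongr
        exact le_rpow_mul_rpow_sub_one hκ0 hκ1 hM hb

theorem exists_tendsto_rpow_neg_mul_pow {δ : ℝ} (hδ : 0 < δ) (p k : ℕ) :
    ∃ κ : ℝ, 0 < κ ∧ κ ≤ 1 ∧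
      Tendsto (fun N : ℝ => N ^ (-δ) * ((N ^ p) ^ κ) ^ k) atTop (𝓝 0) := by
  refine ⟨δ / (δ + p * k), by positivity, ?_, ?_⟩
  · rw [div_le_one (by positivity)]
    exact le_add_of_nonneg_right (by positivity)
  · have hexp : 0 < δ - p * (δ / (δ + p * k)) * k := by
      have : δ - p * (δ / (δ + p * k)) * k = δ ^ 2 / (δ + p * k) := by field_simp; ring
      rw [this]
      positivity
    refine (tendsto_rpow_neg_atTop hexp).congr' ?_
    filter_upwards [eventually_gt_atTop 0] with N hN
    rw [← rpow_natCast N p, ← rpow_mul hN.le, ← rpow_natCast _ k, ← rpow_mul hN.le, ← rpow_add hN]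
    congr 1
    ring

theorem enorm_integral_traceIntegrand_sub_le_of_le_inv {K L : ℝ → ℝ → ℝ} {f : ℝ → ℝ} {n : ℕ}
    {m : Composition n} (hKi : Integrable (traceIntegrand K f m))
    (hLi : Integrable (traceIntegrand L f m)) {A κ : ℝ} (hκ0 : 0 ≤ κ) (hκ1 : κ ≤ 1)
    {F M c ε : ENNReal} (hA : ∀ x, x ∉ Set.Icc (-A) A → f x = 0) (hF : ∀ x, ‖f x‖ₑ ≤ F)
    (hLM : ∀ x y, ‖L x y‖ₑ ≤ M) (hLinv : ∀ x y, x ≠ y → |L x y| ≤ |x - y|⁻¹)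
    (hKL : ∀ x ∈ Set.Icc (-A) A, ∀ y ∈ Set.Icc (-A) A, ‖K x y - L x y‖ₑ ≤ ε) (hε : ε ≤ 1)
    (hc : ∀ x, ∫⁻ y, rieszMajorant A κ M x y ≤ c) :
    ‖(∫ x, traceIntegrand K f m x) - ∫ x, traceIntegrand L f m x‖ₑ ≤
      F ^ n * (m.length * (ε * (c ^ (m.length - 1) * volume (Set.Icc (-A) A)))) :=
  enorm_integral_traceIntegrand_sub_le hKi hLi measurableSet_Icc hA hF
    (fun x hx y hy => enorm_le_rieszMajorant hκ0 hκ1 hx hy ((hKL x hx y hy).trans hε) (hLM x y)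
      (enorm_le_inv_enorm_sub (hLinv x y)))
    (fun x hx y hy => enorm_le_rieszMajorant hκ0 hκ1 hx hy (by simp) (hLM x y)
      (enorm_le_inv_enorm_sub (hLinv x y)))
    hKL (measurable_rieszMajorant A κ M) hc

section Equivalence

variable {K L : ℝ → ℝ → ℝ → ℝ} {δ : ℝ} {p : ℕ}

theorem tendsto_integral_traceIntegrand_sub (hδ : 0 < δ)
    (hKL : ∀ A, ∃ E, ∀ᶠ N in atTop, ∀ x y, |x| ≤ A → |y| ≤ A →
      |K N x y - L N x y| ≤ E * N ^ (-δ))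
    (hLp : ∀ᶠ N in atTop, ∀ x y, |L N x y| ≤ N ^ p)
    (hLinv : ∀ᶠ N in atTop, ∀ x y, x ≠ y → |L N x y| ≤ |x - y|⁻¹)
    {f : ℝ → ℝ} (hf : Continuous f) (hfc : HasCompactSupport f) {n : ℕ} {m : Composition n}
    (hK : ∀ᶠ N in atTop, Integrable (traceIntegrand (K N) f m))
    (hL : ∀ᶠ N in atTop, Integrable (traceIntegrand (L N) f m)) :
    Tendsto (fun N => (∫ x, traceIntegrand (K N) f m x) - ∫ x, traceIntegrand (L N) f m x)
      atTop (𝓝 0) := by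
  obtain ⟨A, hA⟩ := hfc.isCompact.isBounded.subset_closedBall 0
  obtain ⟨F, hF⟩ := hfc.exists_bound_of_continuous hf
  obtain ⟨E, hE⟩ := hKL A
  obtain ⟨κ, hκ0, hκ1, hlim⟩ := exists_tendsto_rpow_neg_mul_pow hδ p (m.length - 1)
  obtain ⟨J, hJ, hJM⟩ := exists_lintegral_rieszMajorant_le A hκ0
  rw [Real.closedBall_eq_Icc, zero_sub, zero_add] at hA
  have hdecay : Tendsto (fun N : ℝ => E * N ^ (-δ)) atTop (𝓝 0) := by
    simpa using (tendsto_rpow_neg_atTop hδ).const_mul E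
  have hbound : ∀ᶠ N in atTop,
      ‖(∫ x, traceIntegrand (K N) f m x) - ∫ x, traceIntegrand (L N) f m x‖ₑ ≤
        ENNReal.ofReal F ^ n * m.length * J ^ (m.length - 1) * volume (Set.Icc (-A) A) *
          ENNReal.ofReal (E * (N ^ (-δ) * ((N ^ p) ^ κ) ^ (m.length - 1))) := by
    filter_upwards [hK, hL, hE, hLp, hLinv, eventually_ge_atTop 1,
      hdecay.eventually_le_const one_pos] with N hKN hLN hEN hLpN hLinvN hN hdN
    refine (enorm_integral_traceIntegrand_sub_le_of_le_inv hKN hLN hκ0.le hκ1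
      (fun x hx => image_eq_zero_of_notMem_tsupport fun h => hx (hA h))
      (fun x => enorm_le_ofReal (hF x)) (fun x y => enorm_le_ofReal (hLpN x y)) hLinvN
      (fun x hx y hy => enorm_le_ofReal (hEN x y (abs_le.2 hx) (abs_le.2 hy)))
      (ENNReal.ofReal_le_one.2 hdN)
      (hJM _ (ENNReal.one_le_ofReal.2 (one_le_pow₀ hN)))).trans_eq ?_
    have : 0 < N := by linarith
    rw [ENNReal.ofReal_rpow_of_pos (by positivity), ← mul_assoc E,
      ENNReal.ofReal_mul' (q := ((N ^ p) ^ κ) ^ _) (by positivity),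
      ENNReal.ofReal_pow (p := (N ^ p) ^ κ) (by positivity), mul_pow]
    ring
  rw [tendsto_zero_iff_enorm_tendsto_zero]
  refine tendsto_of_tendsto_of_tendsto_of_le_of_le' tendsto_const_nhds ?_
    (Eventually.of_forall fun _ => zero_le) hbound
  have hlim' := ENNReal.Tendsto.const_mul (ENNReal.tendsto_ofReal (hlim.const_mul E))
    (a := ENNReal.ofReal F ^ n * m.length * J ^ (m.length - 1) * volume (Set.Icc (-A) A))
    (Or.inr (by rw [Real.volume_Icc]; finiteness))
  simpa only [mul_zero, ENNReal.ofReal_zero] using hlim'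

theorem AsymptoticallyEquivalent.of_abs_sub_le_rpow (hδ : 0 < δ)
    (hK : ∀ᶠ N in atTop, HasCumulants (K N)) (hL : ∀ᶠ N in atTop, HasCumulants (L N))
    (hKL : ∀ A, ∃ E, ∀ᶠ N in atTop, ∀ x y, |x| ≤ A → |y| ≤ A →
      |K N x y - L N x y| ≤ E * N ^ (-δ))
    (hLp : ∀ᶠ N in atTop, ∀ x y, |L N x y| ≤ N ^ p)
    (hLinv : ∀ᶠ N in atTop, ∀ x y, x ≠ y → |L N x y| ≤ |x - y|⁻¹) :
    AsymptoticallyEquivalent K L := by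
  intro f hf hfc n hn
  have htrace (m : Composition n) := tendsto_integral_traceIntegrand_sub (m := m) hδ hKL hLp hLinv
    hf hfc (hK.mono fun N h => h f hf hfc n hn m) (hL.mono fun N h => h f hf hfc n hn m)
  simpa only [kernelCumulant, mul_sub, Finset.sum_sub_distrib, mul_zero, Finset.sum_const_zero]
    using tendsto_finsetSum Finset.univ fun m _ => (htrace m).const_mul
      ((-1) ^ (m.length + 1) / (m.length : ℝ) *
        ((n.factorial : ℝ) / ∏ i, ((m.blocksFun i).factorial : ℝ)))

theorem AsymptoticallyEquivalent.congr_right {L' : ℝ → ℝ → ℝ → ℝ}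
    (h : AsymptoticallyEquivalent K L) (hLL' : ∀ᶠ N in atTop, L N = L' N) :
    AsymptoticallyEquivalent K L' := fun f hf hfc n hn =>
  (h f hf hfc n hn).congr' (hLL'.mono fun N hN => by rw [hN])

end Equivalence

theorem abs_le_exp_div_of_abs_deriv_le {g : ℝ → ℝ} {c : ℝ} (hg : Differentiable ℝ g)
    (hgi : IntegrableOn g (Set.Ioi 0)) (hc : 0 < c)
    (hle : ∀ x, 0 < x → |deriv g x| ≤ exp (-c * x)) {x : ℝ} (hx : 0 ≤ x) :
    |g x| ≤ exp (-c * x) / c := by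
  have hexp (a : ℝ) := integrableOn_exp_mul_Ioi (neg_lt_zero.2 hc) a
  have hle' (a : ℝ) (ha : 0 ≤ a) :
      ∀ᵐ t ∂volume.restrict (Set.Ioi a), ‖deriv g t‖ ≤ exp (-c * t) :=
    ae_restrict_of_forall_mem measurableSet_Ioi fun t ht => hle t (ha.trans_lt ht)
  have hint (a : ℝ) (ha : 0 ≤ a) : IntegrableOn (deriv g) (Set.Ioi a) :=
    (hexp a).mono' (measurable_deriv g).aestronglyMeasurable (hle' a ha)
  have hlim := tendsto_zero_of_hasDerivAt_of_integrableOn_Ioi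
    (fun t _ => (hg t).hasDerivAt) (hint 0 le_rfl) hgi
  have hftc := integral_Ioi_of_hasDerivAt_of_tendsto'
    (fun t _ => (hg t).hasDerivAt) (hint x hx) hlim
  calc |g x| = ‖∫ t in Set.Ioi x, deriv g t‖ := by rw [hftc, zero_sub, norm_neg, norm_eq_abs]
    _ ≤ ∫ t in Set.Ioi x, exp (-c * t) := norm_integral_le_of_norm_le (hexp x) (hle' x hx)
    _ = exp (-c * x) / c := by rw [integral_exp_mul_Ioi (neg_lt_zero.2 hc), neg_div_neg_eq]

theorem le_one_add_inv_mul_exp {g : ℝ → ℝ} {c : ℝ} (hc : 0 < c) (hg : ∀ x, g x ≤ 1)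
    (hexp : ∀ x, 0 ≤ x → g x ≤ exp (-c * x) / c) (x : ℝ) :
    g x ≤ (1 + c⁻¹) * exp (-c * x) := by
  rw [add_mul, one_mul, inv_mul_eq_div]
  rcases le_total 0 x with hx | hx
  · linarith [hexp x hx, exp_pos (-c * x)]
  · have hone : 1 ≤ exp (-c * x) := one_le_exp (by nlinarith)
    have : 0 ≤ exp (-c * x) / c := by positivity
    linarith [hg x]

theorem IsExpShape.exists_isExpTailed {Ψ : ℝ → ℝ} (hΨ : IsExpShape Ψ) :
    ∃ β C, IsExpTailed Ψ β C := by
  obtain ⟨c, hc, hle⟩ := hΨ.density_le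
  have hderiv (x : ℝ) : |deriv Ψ x| ≤ exp (-c * |x|) :=
    (abs_of_nonpos (hΨ.deriv_nonpos x)).trans_le (hle x)
  have hright (x : ℝ) (hx : 0 ≤ x) : |Ψ x| ≤ exp (-c * x) / c :=
    abs_le_exp_div_of_abs_deriv_le hΨ.differentiable hΨ.integrableOn_right hc
      (fun y hy => by simpa only [abs_of_pos hy] using hderiv y) hx
  have hleft (x : ℝ) (hx : 0 ≤ x) : |1 - Ψ (-x)| ≤ exp (-c * x) / c := by
    refine abs_le_exp_div_of_abs_deriv_le (g := fun y => 1 - Ψ (-y))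
      ((hΨ.differentiable.comp differentiable_neg).const_sub 1) ?_ hc (fun y hy => ?_) hx
    · simpa using hΨ.integrableOn_left.comp_neg
    · simpa [deriv_const_sub, deriv_comp_neg, abs_of_pos hy] using hderiv (-y)
  refine ⟨c, 1 + c⁻¹, hc, antitone_of_deriv_nonpos hΨ.differentiable hΨ.deriv_nonpos,
    fun x => (hΨ.mem_Icc x).1, fun x => (hΨ.mem_Icc x).2,
    le_one_add_inv_mul_exp hc (fun x => (hΨ.mem_Icc x).2)
      fun x hx => (le_abs_self _).trans (hright x hx), fun x => ?_⟩
  have h := le_one_add_inv_mul_exp (g := fun y => 1 - Ψ (-y)) hc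
    (fun y => sub_le_self 1 (hΨ.mem_Icc (-y)).1)
    (fun y hy => (le_abs_self _).trans (hleft y hy)) (-x)
  simpa only [neg_neg, neg_mul_neg] using h

theorem criticalSineMixtureKernel_eq_incrementSineKernel {Ψ : ℝ → ℝ} {τ α N : ℝ}
    {ξ : ℝ → ℤ → ℝ} (hξ : ∀ k : ℤ, IsMeanValuePoint Ψ τ α N k (ξ N k)) :
    criticalSineMixtureKernel Ψ τ α ξ N = incrementSineKernel Ψ τ α N := by
  ext x y
  rw [criticalSineMixtureKernel, sineMixtureKernel, incrementSineKernel, Finset.mul_sum]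
  exact Finset.sum_congr rfl fun k _ => by rw [← mul_assoc, (hξ k).2]

theorem mainTheorem6_general {Ψ : ℝ → ℝ} {β C : ℝ} (hΨ : IsExpTailed Ψ β C) {α τ : ℝ}
    (hα : 1 / 3 < α) (hα1 : α < 1) (hτ : 0 < τ) :
    (∀ N : ℝ, 0 < N →
      (∀ x y : ℝ, Summable (modifiedGUETerm Ψ τ α N x y)) ∧
      HasCumulants (criticalModifiedGUEKernel Ψ τ α N) ∧
      HasCumulants (incrementSineKernel Ψ τ α N)) ∧
    AsymptoticallyEquivalent (criticalModifiedGUEKernel Ψ τ α) (incrementSineKernel Ψ τ α) := by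
  have hα0 : 0 < α := by linarith
  have hK (N : ℝ) (hN : 0 < N) : HasCumulants (criticalModifiedGUEKernel Ψ τ α N) :=
    hasCumulants_of_continuous (hΨ.continuous_criticalModifiedGUEKernel hτ hN α)
  have hL (N : ℝ) : HasCumulants (incrementSineKernel Ψ τ α N) :=
    hasCumulants_of_continuous (continuous_incrementSineKernel Ψ τ α N)
  refine ⟨fun N hN => ⟨hΨ.summable_modifiedGUETerm hτ hN α, hK N hN, hL N⟩,
    .of_abs_sub_le_rpow (δ := min (3 * α - 1) α) (p := 2) (lt_min (by linarith) hα0)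
      ((eventually_gt_atTop 0).mono hK) (Eventually.of_forall hL)
      (hΨ.exists_abs_criticalKernel_sub_le hα0 hα1 hτ) ?_ ?_⟩
  · filter_upwards [hΨ.eventually_abs_incrementSineKernel_le hτ hα0.le hα1,
      eventually_ge_atTop 2] with N hLN hN x y
    nlinarith [hLN x y]
  · filter_upwards [eventually_gt_atTop 0] with N hN x y hxy
    exact hΨ.abs_incrementSineKernel_le_inv hτ hN α hxy

end

theorem mainTheorem6 (Ψ : ℝ → ℝ) (hΨ : IsExpShape Ψ) (α τ : ℝ) (hα : 1 / 3 < α) (hα1 : α < 1)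
    (hτ : 0 < τ) (ξ : ℝ → ℤ → ℝ)
    (hξ : ∀ N : ℝ, 0 < N → ∀ k : ℤ, IsMeanValuePoint Ψ τ α N k (ξ N k)) :
    (∀ N : ℝ, 0 < N →
      (∀ x y : ℝ, Summable (modifiedGUETerm Ψ τ α N x y)) ∧
      HasCumulants (criticalModifiedGUEKernel Ψ τ α N) ∧
      HasCumulants (criticalSineMixtureKernel Ψ τ α ξ N)) ∧
    AsymptoticallyEquivalent
      (criticalModifiedGUEKernel Ψ τ α)
      (criticalSineMixtureKernel Ψ τ α ξ) := by
  obtain ⟨β, C, hΨ'⟩ := hΨ.exists_isExpTailed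
  obtain ⟨hcumulants, hequiv⟩ := mainTheorem6_general hΨ' hα hα1 hτ
  have hkernel (N : ℝ) (hN : 0 < N) := criticalSineMixtureKernel_eq_incrementSineKernel (hξ N hN)
  exact ⟨fun N hN => hkernel N hN ▸ hcumulants N hN,
    hequiv.congr_right ((eventually_gt_atTop 0).mono fun N hN => (hkernel N hN).symm)⟩
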